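/- **Setting.** Let $(M,g)$ be a Hausdorff, second countable, smooth Riemannian 4-manifold with a spin structure (hence oriented), let $S$ be an irreducible complex module over the Clifford algebra of Euclidean $\mathbb R^4$ with generators $\gamma_a$, $\gamma_a\gamma_b+\gamma_b\gamma_a=-2\delta_{ab}$, and with a nondegenerate Hermitian form $(s,t)\mapsto\bar s t$ for which every $\gamma_a$ is skew-adjoint; put $\gamma_5=\gamma_0\gamma_1\gamma_2\gamma_3$. Let $\psi$ be a smooth section of the associated spinor bundle and $m,c\in\mathbb R$. Indices refer to the oriented orthonormal frames $(e_a)$ of the spin structure, $\varepsilon_{0123}=1$, repeated indices are summed, and $X_{(\mu\nu)}=\frac12(X_{\mu\nu}+X_{\nu\mu})$, $X_{[\mu\nu]}=\frac12(X_{\mu\nu}-X_{\nu\mu})$. For a smooth metric connection $\nabla$ on $TM$ put $\omega_{\mu ab}=\langle e_a,\nabla_{e_\mu}e_b\rangle$, let $T$ be its torsion, $T_{\tau\mu\nu}=\langle e_\tau,T(e_\mu,e_\nu)\rangle$, $\mathrm{tr}(T)_\rho=T^\sigma{}_{\sigma\rho}$, $\mathrm{Ric}_{\mu\nu}=\langle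 e^\pi,R(e_\pi,e_\mu)e_\nu\rangle$, $\mathrm{Scal}=\mathrm{Ric}^\mu{}_\mu$, and on spinors $$\nabla_\mu\psi=\partial_{e_\mu}\psi-\tfrac14\,\omega_{\mu ab}\gamma_a\gamma_b\psi,\qquad \slashed\nabla\psi=\gamma^\mu\nabla_\mu\psi,\qquad \bar\psi\gamma_\mu\overleftrightarrow{\nabla}_\nu\psi=\bar\psi\gamma_\mu\nabla_\nu\psi-(\overline{\nabla_\nu\psi})\gamma_\mu\psi .$$ Let $\nabla^{LC}$ be the Levi-Civita connection; its Ricci and scalar curvatures carry the label $LC$. For a vector field $A$ write $A$ also for the dual 1-form, and $(\star dA)_{\mu\nu}=\frac12\varepsilon_{ab\mu\nu}(dA)^{ab}$. **Einstein–Cartan–Dirac equations** for $(\nabla,\psi)$, with torsion–spin coupling $c$: $$2\mathrm{Ric}_{\mu\nu}-g_{\mu\nu}\mathrm{Scal}=g_{\mu\nu}\Big(\tfrac12\bar\psi\gamma^\rho\overleftrightarrow\nabla_\rho\psi-m\bar\psi\psi\Big)-\tfrac12\bar\psi\gamma_\mu\overleftrightarrow\nabla_\nu\psi,$$ $$T^\mu{}_{\nu\xi}-\mathrm{tr}(T)_\xi\delta^\mu_\nu+\mathrm{tr}(T)_\nu\delta^\mu_\xi=-\tfrac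 c4\,\bar\psi\{[\gamma_\nu,\gamma_\xi],\gamma^\mu\}\psi,$$ $$\slashed\nabla\psi-\tfrac12\mathrm{tr}(T)_\mu\gamma^\mu\psi-m\psi=0 .$$ **Levi-Civita equations** for a smooth vector field $A$ and $\psi$: $$2\mathrm{Ric}^{LC}_{\mu\nu}-g_{\mu\nu}\mathrm{Scal}^{LC}+\tfrac12\big(A^\xi A_\xi g_{\mu\nu}+2A_\mu A_\nu\big)=-\tfrac12\bar\psi\Big(\gamma_{(\mu}\overleftrightarrow\nabla^{LC}_{\nu)}-\tfrac12\big(A^\xi\gamma_\xi g_{\mu\nu}-A_{(\mu}\gamma_{\nu)}\big)\gamma_5\Big)\psi,$$ $$(\star dA)_{\mu\nu}=\tfrac12\bar\psi\Big(\gamma_{[\mu}\overleftrightarrow\nabla^{LC}_{\nu]}+\tfrac12A_{[\mu}\gamma_{\nu]}\gamma_5\Big)\psi,$$ $$A^\xi=c\,\bar\psi\gamma^\xi\gamma_5\psi,$$ $$\slashed\nabla^{LC}\psi-\tfrac34A^\xi\gamma_\xi\gamma_5\psi-m\psi=0 .$$ **Claim.** (a) For every smooth metric connection $\nabla$: $(\nabla,\psi)$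 satisfies the Einstein–Cartan–Dirac equations if and only if there is a unique smooth vector field $A$ such that the torsion of $\nabla$ is purely axial, $T_{\tau\mu\nu}=A^\xi\varepsilon_{\xi\tau\mu\nu}$, the contorsion is half of the torsion, $\nabla_XY=\nabla^{LC}_XY+\frac12T(X,Y)$, and $(A,\psi)$ satisfies the Levi-Civita equations. (b) Conversely, for every smooth vector field $A$ such that $(A,\psi)$ satisfies the Levi-Civita equations, there is a smooth metric connection $\nabla$ with torsion $T_{\tau\mu\nu}=A^\xi\varepsilon_{\xi\tau\mu\nu}$ and contorsion $\frac12T$ such that $(\nabla,\psi)$ satisfies the Einstein–Cartan–Dirac equations. For $c=-\frac12$ the axial vector is $A^\xi=-\frac12\bar\psi\gamma^\xi\gamma_5\psi$. -/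

import Mathlib

open scoped Manifold ContDiff Bundle

noncomputable section

/-- The Euclidean model space of dimension four. -/
abbrev E4 : Type := EuclideanSpace ℝ (Fin 4)

/-- The Kronecker symbol; it is the metric in an orthonormal frame. -/
def kron (a b : Fin 4) : ℝ := if a = b then 1 else 0

/-- The Levi-Civita symbol with four indices, `levi 0 1 2 3 = 1`. -/
def levi (a b c d : Fin 4) : ℝ :=
  (((Matrix.of fun i j : Fin 4 => if ![a, b, c, d] i = j then (1 : ℤ) else 0).det : ℤ) : ℝ)

/-! ### Dirac spinors -/

/-- An irreducible complex module `S` over the Clifford algebra of Euclidean `ℝ⁴`, with the sign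
`u v + v u = - 2 ⟨u, v⟩`, together with a spinor metric: a nondegenerate Hermitian form for which
the vectors of `ℝ⁴` act as skew-adjoint operators. -/
structure DiracModule (S : Type*) [NormedAddCommGroup S] [NormedSpace ℂ S] where
  γ : Fin 4 → S →L[ℂ] S
  clifford : ∀ a b, γ a * γ b + γ b * γ a = ((-2 * kron a b : ℝ) : ℂ) • (1 : S →L[ℂ] S)
  nontrivial : Nontrivial S
  irreducible : ∀ W : Submodule ℂ S, (∀ a, ∀ s ∈ W, γ a s ∈ W) → W = ⊥ ∨ W = ⊤
  /-- The spinor metric `(s, t) ↦ s̄ t`. -/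
  form : S →L⋆[ℂ] S →L[ℂ] ℂ
  form_symm : ∀ s t, starRingEnd ℂ (form s t) = form t s
  form_nondegenerate : ∀ s, (∀ t, form s t = 0) → s = 0
  form_skew : ∀ a s t, form (γ a s) t = - form s (γ a t)

namespace DiracModule

variable {S : Type*} [NormedAddCommGroup S] [NormedSpace ℂ S] (C : DiracModule S)

/-- The chirality operator `γ₅ = γ₀ γ₁ γ₂ γ₃`. -/
def γ5 : S →L[ℂ] S := C.γ 0 * C.γ 1 * C.γ 2 * C.γ 3

/-- Clifford multiplication by a vector of `ℝ⁴`. -/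
def vec (u : E4) : S →L[ℂ] S := ∑ a, ((u a : ℝ) : ℂ) • C.γ a

/-- The group `Spin₄` acting on spinors: products of an even number of unit vectors. -/
def spin : Submonoid (S →L[ℂ] S) :=
  Submonoid.closure {g | ∃ u v : E4, ‖u‖ = 1 ∧ ‖v‖ = 1 ∧ g = C.vec u * C.vec v}

end DiracModule

/-! ### Spacetime with a spin structure -/

section Geometry

variable {M : Type*} [TopologicalSpace M] [ChartedSpace E4 M] [IsManifold 𝓘(ℝ, E4) ∞ M]
  [Bundle.RiemannianBundle (fun x : M => TangentSpace 𝓘(ℝ, E4) x)]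
  {S : Type*} [NormedAddCommGroup S] [NormedSpace ℂ S]

/-- The vector field `X` is smooth on the set `u`. -/
def SmoothVectorFieldOn (X : Π x : M, TangentSpace 𝓘(ℝ, E4) x) (u : Set M) : Prop :=
  ContMDiffOn 𝓘(ℝ, E4) (𝓘(ℝ, E4).prod 𝓘(ℝ, E4)) ∞
    (fun x => (⟨x, X x⟩ : TangentBundle 𝓘(ℝ, E4) M)) u

variable (M) in
/-- A spin structure (and the orientation it carries) on a Riemannian manifold of dimension four,
given by local trivialisations of the spin frame bundle: over each `U i` a smooth orthonormal
frame (declared direct), and over overlaps smooth `Spin₄`-valued transition functions, subject to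
the cocycle relation, that cover the change of frames. -/
structure SpinStructure (C : DiracModule S) (ι : Type*) where
  U : ι → Set M
  isOpen_U : ∀ i, IsOpen (U i)
  cover : ∀ x, ∃ i, x ∈ U i
  frame : ι → Fin 4 → Π x : M, TangentSpace 𝓘(ℝ, E4) x
  frame_smooth : ∀ i a, SmoothVectorFieldOn (frame i a) (U i)
  frame_orthonormal : ∀ i, ∀ x ∈ U i, ∀ a b, inner ℝ (frame i a x) (frame i b x) = kron a b
  trans : ι → ι → M → S →L[ℂ] S
  trans_smooth : ∀ i j,
    ContMDiffOn 𝓘(ℝ, E4) 𝓘(ℝ, S →L[ℂ] S) ∞ (trans i j) (U i ∩ U j)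
  trans_mem : ∀ i j, ∀ x ∈ U i ∩ U j, trans i j x ∈ C.spin
  trans_cocycle : ∀ i j k, ∀ x ∈ U i ∩ U j ∩ U k, trans i j x * trans j k x = trans i k x
  trans_frame : ∀ i j, ∀ x ∈ U i ∩ U j, ∀ a,
    trans i j x * C.γ a =
      (∑ b, ((inner ℝ (frame i b x) (frame j a x) : ℝ) : ℂ) • C.γ b) * trans i j x

/-- A smooth section of the spinor bundle, in the local trivialisations. -/
structure SpinorField {C : DiracModule S} {ι : Type*} (P : SpinStructure M C ι) where
  ψ : ι → M → S
  smooth : ∀ i, ContMDiffOn 𝓘(ℝ, E4) 𝓘(ℝ, S) ∞ (ψ i) (P.U i)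
  compat : ∀ i j, ∀ x ∈ P.U i ∩ P.U j, ψ i x = P.trans i j x (ψ j x)

variable (M) in
/-- Affine connections on `M`. Caution: `∇ Y x X` is `(∇_X Y)(x)`. -/
abbrev AffineConnection : Type _ :=
  CovariantDerivative 𝓘(ℝ, E4) E4 (fun x : M => TangentSpace 𝓘(ℝ, E4) x)

/-- Curvature `R(X, Y) Z = ∇_X ∇_Y Z - ∇_Y ∇_X Z - ∇_[X, Y] Z`. -/
def AffineConnection.curvature (cov : AffineConnection M)
    (X Y Z : Π x : M, TangentSpace 𝓘(ℝ, E4) x) (x : M) : TangentSpace 𝓘(ℝ, E4) x :=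
  cov (fun y => cov Z y (Y y)) x (X x) - cov (fun y => cov Z y (X y)) x (Y x)
    - cov Z x (VectorField.mlieBracket 𝓘(ℝ, E4) X Y x)

/-- The derivative at `x` of a function with values in a vector space, along the tangent vector
`X`. -/
def dirDeriv {V : Type*} [NormedAddCommGroup V] [NormedSpace ℝ V] (f : M → V) (x : M)
    (X : TangentSpace 𝓘(ℝ, E4) x) : V :=
  mfderiv 𝓘(ℝ, E4) 𝓘(ℝ, V) f x X

variable [IsContMDiffRiemannianBundle 𝓘(ℝ, E4) ∞ E4 (fun x : M => TangentSpace 𝓘(ℝ, E4) x)]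

instance instRiemannianOne :
    IsContMDiffRiemannianBundle 𝓘(ℝ, E4) 1 E4 (fun x : M => TangentSpace 𝓘(ℝ, E4) x) :=
  IsContMDiffRiemannianBundle.of_le (n := ∞) (by norm_cast)

/-- Smooth connections compatible with the metric. -/
structure IsMetricConnection (cov : AffineConnection M) : Prop where
  smooth : CovariantDerivative.ContMDiffCovariantDerivative cov ∞
  metric : cov.IsMetricCompatible

/-- The Levi-Civita connection: metric and torsion-free. -/
structure IsLeviCivita (cov : AffineConnection M) : Prop extends IsMetricConnection cov where
  torsion_free : cov.torsion = 0

/-- The contorsion `cov - lc` is half of the torsion of `cov`. -/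
def HasHalfTorsionContorsion (cov lc : AffineConnection M) : Prop :=
  ∀ (x : M) (Y : Π y : M, TangentSpace 𝓘(ℝ, E4) y),
    MDifferentiableAt 𝓘(ℝ, E4) (𝓘(ℝ, E4).prod 𝓘(ℝ, E4))
      (fun y => (⟨y, Y y⟩ : TangentBundle 𝓘(ℝ, E4) M)) x →
    ∀ X : TangentSpace 𝓘(ℝ, E4) x,
      cov Y x X = lc Y x X + (1 / 2 : ℝ) • cov.torsion x X (Y x)

namespace SpinStructure

variable {C : DiracModule S} {ι : Type*} (P : SpinStructure M C ι)

/-! Components are taken in the orthonormal frame of the trivialisation `i`, so that the position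
of the indices does not matter. -/

/-- The components `A_a` of a vector field. -/
def comp (A : Π x : M, TangentSpace 𝓘(ℝ, E4) x) (i : ι) (x : M) (a : Fin 4) : ℝ :=
  inner ℝ (P.frame i a x) (A x)

/-- The squared length `A^ξ A_ξ`. -/
def sqLength (A : Π x : M, TangentSpace 𝓘(ℝ, E4) x) (i : ι) (x : M) : ℝ :=
  ∑ ξ, P.comp A i x ξ * P.comp A i x ξ

/-- The components `⟨e_a, ∇_{e_μ} e_b⟩` of the connection form. -/
def connForm (cov : AffineConnection M) (i : ι) (x : M) (μ a b : Fin 4) : ℝ :=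
  inner ℝ (P.frame i a x) (cov (P.frame i b) x (P.frame i μ x))

/-- The components `T_{τμν} = ⟨e_τ, T(e_μ, e_ν)⟩` of the torsion. -/
def tors (cov : AffineConnection M) (i : ι) (x : M) (τ μ ν : Fin 4) : ℝ :=
  inner ℝ (P.frame i τ x) (cov.torsion x (P.frame i μ x) (P.frame i ν x))

/-- The trace `tr(T)_ρ = T^σ_{σρ}`. -/
def trTors (cov : AffineConnection M) (i : ι) (x : M) (ρ : Fin 4) : ℝ :=
  ∑ σ, P.tors cov i x σ σ ρ

/-- The Ricci curvature `Ric_{μν} = e^τ(R(e_τ, e_μ) e_ν)`: the trace is over the first form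
index, and the second form index comes first. -/
def ric (cov : AffineConnection M) (i : ι) (x : M) (μ ν : Fin 4) : ℝ :=
  ∑ τ, inner ℝ (P.frame i τ x)
    (AffineConnection.curvature cov (P.frame i τ) (P.frame i μ) (P.frame i ν) x)

/-- The scalar curvature. -/
def scal (cov : AffineConnection M) (i : ι) (x : M) : ℝ := ∑ μ, P.ric cov i x μ μ

/-- The components of the exterior derivative of the `1`-form `A^♭`,
`dA(X, Y) = X(A(Y)) - Y(A(X)) - A([X, Y])`. -/
def extD (A : Π x : M, TangentSpace 𝓘(ℝ, E4) x) (i : ι) (x : M) (a b : Fin 4) : ℝ :=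
  dirDeriv (fun y => P.comp A i y b) x (P.frame i a x)
    - dirDeriv (fun y => P.comp A i y a) x (P.frame i b x)
    - inner ℝ (A x) (VectorField.mlieBracket 𝓘(ℝ, E4) (P.frame i a) (P.frame i b) x)

/-- The Hodge dual `(⋆dA)_{μν} = ½ ε_{abμν} (dA)^{ab}`. -/
def starExtD (A : Π x : M, TangentSpace 𝓘(ℝ, E4) x) (i : ι) (x : M) (μ ν : Fin 4) : ℝ :=
  (1 / 2) * ∑ a, ∑ b, levi a b μ ν * P.extD A i x a b

/-- The torsion is `A ⌟ vol`, that is `T_{τμν} = A^ξ ε_{ξτμν}`. -/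
def HasAxialTorsion (cov : AffineConnection M) (A : Π x : M, TangentSpace 𝓘(ℝ, E4) x) : Prop :=
  ∀ i, ∀ x ∈ P.U i, ∀ τ μ ν, P.tors cov i x τ μ ν = ∑ ξ, P.comp A i x ξ * levi ξ τ μ ν

end SpinStructure

namespace SpinorField

variable {C : DiracModule S} {ι : Type*} {P : SpinStructure M C ι} (Ψ : SpinorField P)

/-- The covariant derivative `∇_μ ψ` of the spinor field for the metric connection `cov`. In view
of `γ_a γ_b + γ_b γ_a = - 2 δ_{ab}`, the element of `spin₄` that corresponds to the skew matrix
`ω_{ab}` is `- ¼ ω_{ab} γ_a γ_b`; its commutator with `γ_c` is `ω_{ac} γ_a`. -/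
def deriv (cov : AffineConnection M) (i : ι) (x : M) (μ : Fin 4) : S :=
  dirDeriv (Ψ.ψ i) x (P.frame i μ x)
    - (1 / 4 : ℂ) • ∑ a, ∑ b, ((P.connForm cov i x μ a b : ℝ) : ℂ) • C.γ a (C.γ b (Ψ.ψ i x))

/-- The Dirac operator `γ^μ ∇_μ ψ`. -/
def dirac (cov : AffineConnection M) (i : ι) (x : M) : S := ∑ μ, C.γ μ (Ψ.deriv cov i x μ)

/-- The bilinear `ψ̄ B ψ`. -/
def bil (B : S →L[ℂ] S) (i : ι) (x : M) : ℂ := C.form (Ψ.ψ i x) (B (Ψ.ψ i x))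

/-- The two-sided derivative `ψ̄ γ_μ ∇_ν ψ - (∇_ν ψ̄) γ_μ ψ`. -/
def kin (cov : AffineConnection M) (i : ι) (x : M) (μ ν : Fin 4) : ℂ :=
  C.form (Ψ.ψ i x) (C.γ μ (Ψ.deriv cov i x ν)) - C.form (Ψ.deriv cov i x ν) (C.γ μ (Ψ.ψ i x))

/-- The current `ψ̄ {[γ_ν, γ_ξ], γ_μ} ψ`. -/
def spinCurrent (i : ι) (x : M) (μ ν ξ : Fin 4) : ℂ :=
  Ψ.bil ((C.γ ν * C.γ ξ - C.γ ξ * C.γ ν) * C.γ μ + C.γ μ * (C.γ ν * C.γ ξ - C.γ ξ * C.γ ν)) i x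

/-- The chiral current `ψ̄ γ_ξ γ₅ ψ`. -/
def chiralCurrent (i : ι) (x : M) (ξ : Fin 4) : ℂ := Ψ.bil (C.γ ξ * C.γ5) i x

/-- The Einstein–Cartan–Dirac equations with mass `m` for a metric connection; the real number `c`
is the strength of the coupling of the torsion to the spin. -/
structure EinsteinCartanDirac (cov : AffineConnection M) (m c : ℝ) : Prop where
  einstein : ∀ i, ∀ x ∈ P.U i, ∀ μ ν,
    ((2 * P.ric cov i x μ ν - kron μ ν * P.scal cov i x : ℝ) : ℂ) =
      (kron μ ν : ℂ) * ((1 / 2) * ∑ ρ, Ψ.kin cov i x ρ ρ - (m : ℂ) * Ψ.bil 1 i x)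
        - (1 / 2) * Ψ.kin cov i x μ ν
  torsion : ∀ i, ∀ x ∈ P.U i, ∀ μ ν ξ,
    ((P.tors cov i x μ ν ξ - P.trTors cov i x ξ * kron μ ν + P.trTors cov i x ν * kron μ ξ : ℝ) : ℂ)
      = - ((c : ℂ) / 4) * Ψ.spinCurrent i x μ ν ξ
  dirac : ∀ i, ∀ x ∈ P.U i,
    Ψ.dirac cov i x - (1 / 2 : ℂ) • ∑ μ, ((P.trTors cov i x μ : ℝ) : ℂ) • C.γ μ (Ψ.ψ i x)
      - (m : ℂ) • Ψ.ψ i x = 0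

/-- The equations of the theory with the Levi-Civita connection `lc` and an axial vector `A`.
Symmetrisation and antisymmetrisation carry a factor `½`. -/
structure LeviCivitaAxial (lc : AffineConnection M) (A : Π x : M, TangentSpace 𝓘(ℝ, E4) x)
    (m c : ℝ) : Prop where
  einstein : ∀ i, ∀ x ∈ P.U i, ∀ μ ν,
    ((2 * P.ric lc i x μ ν - kron μ ν * P.scal lc i x
        + (1 / 2) * (P.sqLength A i x * kron μ ν + 2 * P.comp A i x μ * P.comp A i x ν) : ℝ) : ℂ) =
      - (1 / 2) * ((1 / 2) * (Ψ.kin lc i x μ ν + Ψ.kin lc i x ν μ)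
        - (1 / 2) * ((kron μ ν : ℂ) * ∑ ξ, (P.comp A i x ξ : ℂ) * Ψ.chiralCurrent i x ξ
          - (1 / 2) * ((P.comp A i x μ : ℂ) * Ψ.chiralCurrent i x ν
            + (P.comp A i x ν : ℂ) * Ψ.chiralCurrent i x μ)))
  star_dA : ∀ i, ∀ x ∈ P.U i, ∀ μ ν,
    ((P.starExtD A i x μ ν : ℝ) : ℂ) =
      (1 / 2) * ((1 / 2) * (Ψ.kin lc i x μ ν - Ψ.kin lc i x ν μ)
        + (1 / 2) * ((1 / 2) * ((P.comp A i x μ : ℂ) * Ψ.chiralCurrent i x ν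
            - (P.comp A i x ν : ℂ) * Ψ.chiralCurrent i x μ)))
  axial : ∀ i, ∀ x ∈ P.U i, ∀ ξ, (P.comp A i x ξ : ℂ) = (c : ℂ) * Ψ.chiralCurrent i x ξ
  dirac : ∀ i, ∀ x ∈ P.U i,
    Ψ.dirac lc i x
      - (3 / 4 : ℂ) • ∑ ξ, ((P.comp A i x ξ : ℝ) : ℂ) • C.γ ξ (C.γ5 (Ψ.ψ i x))
      - (m : ℂ) • Ψ.ψ i x = 0

end SpinorField

end Geometry

end

/-! The torsion equation is algebraic. By the Clifford identity `clifford_triple`, the spin current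
{[γ_ν, γ_ξ], γ_μ} is totally antisymmetric and dual to the chiral current, so the right-hand side is
A ⌟ vol with A = c ψ̄γγ₅ψ. Tracing the equation kills tr(T), and the torsion is exactly that 3-form.
A metric connection is determined by its torsion, and for a totally antisymmetric torsion the
contorsion is half of it (`connForm_eq`).

Inserting ∇ = ∇^LC + ½T into the remaining equations gives Ric = Ric^LC - ½⋆dA - ½(|A|²g - A⊗A)
(`ric_eq`) and Scal = Scal^LC - (3/2)|A|² (`scal_eq`). The Dirac operator is shifted by -¾Aγγ₅
(`dirac_eq`), and the kinetic bilinear by terms in A and the chiral current (`kin_eq`). The Dirac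
equation makes the bracket multiplying g in the Einstein equation vanish. Since Ric^LC is symmetric
(`ric_symm`) and ⋆dA antisymmetric, the Einstein equation is equivalent to its symmetric part, the
Levi-Civita Einstein equation, together with its antisymmetric part, the equation for ⋆dA. This is
`einsteinCartanDirac_iff_leviCivitaAxial`.

What is left is global. The currents are real and independent of the trivialisation because `Spin₄`
preserves the spinor metric, commutes with γ₅ and intertwines Clifford multiplication; hence A is a
smooth vector field, and the axial equation makes it unique. For the converse, the connection is the
Levi-Civita connection plus a contorsion written with the spin current ψ̄{[·,·],·}ψ instead of A and
ε. Its invariance under change of frame then follows from the Clifford action, and the determinant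
of the frame change is never needed. -/

noncomputable section

/-! ### The Levi-Civita symbol -/

/-- The Vandermonde product of a permutation of 0, 1, 2, 3 is its sign times 1!·2!·3! = 12, and it
vanishes on a repeated index. In this polynomial form `ring` proves antisymmetry and `simp`
evaluates components. -/
theorem levi_eq_vandermonde (a b c d : Fin 4) :
    levi a b c d = (((b : ℕ) : ℝ) - (a : ℕ)) * (((c : ℕ) : ℝ) - (a : ℕ)) * (((d : ℕ) : ℝ) - (a : ℕ)) *
      (((c : ℕ) : ℝ) - (b : ℕ)) * (((d : ℕ) : ℝ) - (b : ℕ)) * (((d : ℕ) : ℝ) - (c : ℕ)) / 12 := by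
  have h : ∀ a b c d : Fin 4,
      12 * (Matrix.of fun i j : Fin 4 => if ![a, b, c, d] i = j then (1 : ℤ) else 0).det =
      (((b : ℕ) : ℤ) - (a : ℕ)) * (((c : ℕ) : ℤ) - (a : ℕ)) * (((d : ℕ) : ℤ) - (a : ℕ)) *
      (((c : ℕ) : ℤ) - (b : ℕ)) * (((d : ℕ) : ℤ) - (b : ℕ)) * (((d : ℕ) : ℤ) - (c : ℕ)) := by
    decide +kernel
  rw [levi, eq_div_iff (by norm_num), mul_comm]
  exact_mod_cast h a b c d

/-! ### The Clifford identity behind the axial torsion -/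

section Clifford
variable {R : Type*} [Ring R] [Algebra ℂ R] {γ : Fin 4 → R}

-- For distinct indices [γ_a, γ_b] = 2γ_aγ_b commutes with γ_c, so the anticommutator is 4γ_aγ_bγ_c,
-- and a triple product is, up to sign, γ_rγ₅ for the missing index r. For repeated indices both
-- sides vanish. The proof orders the generators with the relations below, case by case.
set_option maxHeartbeats 4000000 in
theorem clifford_triple (hγ : ∀ a b, γ a * γ b + γ b * γ a = ((-2 * kron a b : ℝ) : ℂ) • (1 : R))
    (a b c : Fin 4) :
    (γ a * γ b - γ b * γ a) * γ c + γ c * (γ a * γ b - γ b * γ a) =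
      ∑ r, ((-4 * levi r a b c : ℝ) : ℂ) • (γ r * (γ 0 * γ 1 * γ 2 * γ 3)) := by
  have sq : ∀ a, γ a * γ a = -1 := by
    intro a
    have h := hγ a a
    have : (2 : ℂ) • (γ a * γ a) = (2 : ℂ) • (-1 : R) := by
      rw [two_smul, h]; simp [kron]
    exact (smul_right_injective R (two_ne_zero' ℂ)) this
  have sw : ∀ a b, a ≠ b → γ b * γ a = -(γ a * γ b) := by
    intro a b hab
    have h := hγ a b
    simp [kron, hab] at h
    exact eq_neg_of_add_eq_zero_right h
  have sq' : ∀ a (x : R), γ a * (γ a * x) = -x := by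
    intro a x; rw [← mul_assoc, sq]; simp
  have sw' : ∀ a b (x : R), a ≠ b → γ b * (γ a * x) = -(γ a * (γ b * x)) := by
    intro a b x h; rw [← mul_assoc, sw a b h]; simp [mul_assoc]
  have s10 := sw 0 1 (by decide)
  have s20 := sw 0 2 (by decide)
  have s30 := sw 0 3 (by decide)
  have s21 := sw 1 2 (by decide)
  have s31 := sw 1 3 (by decide)
  have s32 := sw 2 3 (by decide)
  have t10 := fun x => sw' 0 1 x (by decide)
  have t20 := fun x => sw' 0 2 x (by decide)
  have t30 := fun x => sw' 0 3 x (by decide)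
  have t21 := fun x => sw' 1 2 x (by decide)
  have t31 := fun x => sw' 1 3 x (by decide)
  have t32 := fun x => sw' 2 3 x (by decide)
  simp only [Fin.sum_univ_four, levi_eq_vandermonde]
  fin_cases a <;> fin_cases b <;> fin_cases c <;>
    simp [mul_assoc, sub_mul, mul_sub, add_mul, mul_add, sq, sq', s10, s20, s30, s21, s31, s32,
      t10, t20, t30, t21, t31, t32] <;> norm_num <;> module

end Clifford

/-! ### Spin frames as orthonormal bases, and smoothness of covariant derivatives along them -/

section Frames

/-- The vector field `X` is smooth at the point `x`. -/
abbrev SmoothVectorFieldAt {M : Type*} [TopologicalSpace M] [ChartedSpace E4 M]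
    [IsManifold 𝓘(ℝ, E4) ∞ M] (X : Π x : M, TangentSpace 𝓘(ℝ, E4) x) (x : M) : Prop :=
  ContMDiffAt 𝓘(ℝ, E4) (𝓘(ℝ, E4).prod 𝓘(ℝ, E4)) ∞
    (fun y => (⟨y, X y⟩ : TangentBundle 𝓘(ℝ, E4) M)) x

/-- The vector field `X` is differentiable at the point `x`. -/
abbrev DiffVectorFieldAt {M : Type*} [TopologicalSpace M] [ChartedSpace E4 M]
    [IsManifold 𝓘(ℝ, E4) ∞ M] (X : Π x : M, TangentSpace 𝓘(ℝ, E4) x) (x : M) : Prop :=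
  MDifferentiableAt 𝓘(ℝ, E4) (𝓘(ℝ, E4).prod 𝓘(ℝ, E4))
    (fun y => (⟨y, X y⟩ : TangentBundle 𝓘(ℝ, E4) M)) x

open Filter Topology

variable {M : Type*} [TopologicalSpace M] [ChartedSpace E4 M] [IsManifold 𝓘(ℝ, E4) ∞ M]

/-- A vector field that is smooth near a point agrees near the point with a smooth vector field. -/
theorem exists_contMDiff_eventuallyEq [T2Space M] {X : Π x : M, TangentSpace 𝓘(ℝ, E4) x} {u : Set M}
    (hu : IsOpen u) (hX : SmoothVectorFieldOn X u) {x : M} (hx : x ∈ u) :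
    ∃ Y : Π x : M, TangentSpace 𝓘(ℝ, E4) x, (∀ y, SmoothVectorFieldAt Y y) ∧
      ∀ᶠ y in 𝓝 x, Y y = X y := by
  -- The field is cut off by a bump function supported in `u`.
  obtain ⟨f, hf⟩ : ∃ f : SmoothBumpFunction 𝓘(ℝ, E4) x, tsupport f ⊆ u :=
    ((SmoothBumpFunction.nhds_basis_tsupport x).mem_iff.1 (hu.mem_nhds hx)).imp fun f hf => hf.2
  refine ⟨fun y => f y • X y, ?_, ?_⟩
  · exact ContMDiffOn.smul_section_of_tsupport f.contMDiff.contMDiffOn hu hf hX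
  · filter_upwards [f.eventuallyEq_one] with y hy
    simp [hy]

variable [Bundle.RiemannianBundle (fun x : M => TangentSpace 𝓘(ℝ, E4) x)]
  {S : Type*} [NormedAddCommGroup S] [NormedSpace ℂ S]
  {C : DiracModule S} {ι : Type*} (P : SpinStructure M C ι)

namespace SpinStructure

theorem orthonormal_frame {i : ι} {x : M} (hx : x ∈ P.U i) :
    Orthonormal ℝ (fun a => P.frame i a x) := by
  rw [orthonormal_iff_ite]
  intro a b
  rw [P.frame_orthonormal i x hx a b, kron]

theorem span_frame {i : ι} {x : M} (hx : x ∈ P.U i) :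
    ⊤ ≤ Submodule.span ℝ (Set.range fun a => P.frame i a x) := by
  have h := (P.orthonormal_frame hx).linearIndependent
  have hf : Module.finrank ℝ (TangentSpace 𝓘(ℝ, E4) x) = 4 := by
    change Module.finrank ℝ E4 = 4
    simp
  have : FiniteDimensional ℝ (TangentSpace 𝓘(ℝ, E4) x) :=
    inferInstanceAs (FiniteDimensional ℝ E4)
  exact (h.span_eq_top_of_card_eq_finrank' (by simp [hf])).ge

/-- The orthonormal basis of the tangent space that a spin frame provides. -/
def frameBasis {i : ι} {x : M} (hx : x ∈ P.U i) :
    OrthonormalBasis (Fin 4) ℝ (TangentSpace 𝓘(ℝ, E4) x) :=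
  OrthonormalBasis.mk (P.orthonormal_frame hx) (P.span_frame hx)

theorem frameBasis_apply {i : ι} {x : M} (hx : x ∈ P.U i) (a : Fin 4) :
    P.frameBasis hx a = P.frame i a x := by
  simp [frameBasis]

theorem sum_inner_smul_frame {i : ι} {x : M} (hx : x ∈ P.U i) (v : TangentSpace 𝓘(ℝ, E4) x) :
    ∑ a, inner ℝ (P.frame i a x) v • P.frame i a x = v := by
  simpa [frameBasis_apply] using (P.frameBasis hx).sum_repr' v

theorem ext_inner_frame {i : ι} {x : M} (hx : x ∈ P.U i) {v w : TangentSpace 𝓘(ℝ, E4) x}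
    (h : ∀ a, inner ℝ (P.frame i a x) v = inner ℝ (P.frame i a x) w) : v = w := by
  rw [← P.sum_inner_smul_frame hx v, ← P.sum_inner_smul_frame hx w]
  simp [h]

theorem sum_inner_frame_mul_inner_frame {i : ι} {x : M} (hx : x ∈ P.U i)
    (v w : TangentSpace 𝓘(ℝ, E4) x) :
    ∑ a, inner ℝ (P.frame i a x) v * inner ℝ (P.frame i a x) w = inner ℝ v w := by
  conv_rhs => rw [← P.sum_inner_smul_frame hx v]
  simp [sum_inner, inner_smul_left]

theorem mem_nhds_U {i : ι} {x : M} (hx : x ∈ P.U i) : P.U i ∈ 𝓝 x :=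
  (P.isOpen_U i).mem_nhds hx

theorem contMDiffAt_frame {i : ι} {x : M} (hx : x ∈ P.U i) (a : Fin 4) :
    SmoothVectorFieldAt (P.frame i a) x :=
  (P.frame_smooth i a).contMDiffAt (P.mem_nhds_U hx)

theorem mdifferentiableAt_frame {i : ι} {x : M} (hx : x ∈ P.U i) (a : Fin 4) :
    DiffVectorFieldAt (P.frame i a) x :=
  (P.contMDiffAt_frame hx a).mdifferentiableAt (by simp)

end SpinStructure

variable [IsContMDiffRiemannianBundle 𝓘(ℝ, E4) ∞ E4 (fun x : M => TangentSpace 𝓘(ℝ, E4) x)]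

theorem SmoothVectorFieldAt.inner {X Y : Π x : M, TangentSpace 𝓘(ℝ, E4) x} {x : M}
    (hX : SmoothVectorFieldAt X x) (hY : SmoothVectorFieldAt Y x) :
    ContMDiffAt 𝓘(ℝ, E4) 𝓘(ℝ) ∞ (fun y => (inner ℝ (X y) (Y y) : ℝ)) x :=
  ContMDiffAt.inner_bundle hX hY

theorem DiffVectorFieldAt.inner {X Y : Π x : M, TangentSpace 𝓘(ℝ, E4) x} {x : M}
    (hX : DiffVectorFieldAt X x) (hY : DiffVectorFieldAt Y x) :
    MDifferentiableAt 𝓘(ℝ, E4) 𝓘(ℝ) (fun y => (inner ℝ (X y) (Y y) : ℝ)) x :=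
  MDifferentiableAt.inner_bundle hX hY

theorem contMDiffAt_cov [T2Space M] {cov : AffineConnection M} (hcov : IsMetricConnection cov)
    {X Y : Π x : M, TangentSpace 𝓘(ℝ, E4) x} {u : Set M}
    (hu : IsOpen u) (hX : SmoothVectorFieldOn X u) (hY : SmoothVectorFieldOn Y u) {x : M}
    (hx : x ∈ u) : SmoothVectorFieldAt (fun y => cov Y y (X y)) x := by
  -- Smoothness of `cov` is stated for sections smooth on the whole manifold, while frames live on
  -- an open set; locality of `cov` transfers the result from the extension `Z` back to `Y`.
  obtain ⟨Z, hZ, hZY⟩ := exists_contMDiff_eventuallyEq hu hY hx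
  have h1 := hcov.smooth.contMDiff.contMDiff (σ := Z)
    (fun y _ => ((hZ y).of_le le_rfl).contMDiffWithinAt)
  have h2 : SmoothVectorFieldAt (fun y => cov Z y (X y)) x := by
    have := contMDiffOn_univ.1 h1 x
    have hXx := hX.contMDiffAt (hu.mem_nhds hx)
    exact ContMDiffAt.clm_bundle_apply this hXx
  refine h2.congr_of_eventuallyEq ?_
  filter_upwards [eventually_eventually_nhds.2 hZY, hu.mem_nhds hx] with y hy hyu
  congr 2
  exact cov.isCovariantDerivativeOn.congr_of_eventuallyEq (s := Set.univ)
    ((hY.contMDiffAt (hu.mem_nhds hyu)).mdifferentiableAt (by simp))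
    ((hZ y).mdifferentiableAt (by simp)) univ_mem (hy.mono fun _ h => h.symm)

end Frames

/-! ### Directional derivatives, connection forms and curvature in a frame -/

section Connections

open Filter Topology

variable {M : Type*} [TopologicalSpace M] [ChartedSpace E4 M]

section DirDeriv

variable {V : Type*} [NormedAddCommGroup V] [NormedSpace ℝ V] {f g : M → V} {x : M}
  (X : TangentSpace 𝓘(ℝ, E4) x)

theorem dirDeriv_congr (h : f =ᶠ[𝓝 x] g) : dirDeriv f x X = dirDeriv g x X := by
  rw [dirDeriv, dirDeriv, h.mfderiv_eq]
  rfl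

theorem dirDeriv_const (c : V) : dirDeriv (fun _ : M => c) x X = 0 := by
  rw [dirDeriv, mfderiv_const]
  rfl

theorem dirDeriv_neg : dirDeriv (fun y => -f y) x X = -dirDeriv f x X := by
  rw [dirDeriv, dirDeriv, show (fun y => -f y) = -f from rfl, mfderiv_neg]
  rfl

theorem dirDeriv_add (hf : MDifferentiableAt 𝓘(ℝ, E4) 𝓘(ℝ, V) f x)
    (hg : MDifferentiableAt 𝓘(ℝ, E4) 𝓘(ℝ, V) g x) :
    dirDeriv (fun y => f y + g y) x X = dirDeriv f x X + dirDeriv g x X := by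
  have h := mfderiv_add hf hg
  rw [dirDeriv, dirDeriv, dirDeriv, show (fun y => f y + g y) = f + g from rfl]
  rw [h]
  rfl

theorem dirDeriv_const_smul (c : ℝ) (hf : MDifferentiableAt 𝓘(ℝ, E4) 𝓘(ℝ, V) f x) :
    dirDeriv (fun y => c • f y) x X = c • dirDeriv f x X := by
  have h := const_smul_mfderiv hf c
  rw [dirDeriv, dirDeriv, show (fun y => c • f y) = c • f from rfl]
  rw [h]
  rfl

theorem dirDeriv_sum {κ : Type*} (s : Finset κ) {F : κ → M → V}
    (hF : ∀ k, MDifferentiableAt 𝓘(ℝ, E4) 𝓘(ℝ, V) (F k) x) :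
    MDifferentiableAt 𝓘(ℝ, E4) 𝓘(ℝ, V) (fun y => ∑ k ∈ s, F k y) x ∧
    dirDeriv (fun y => ∑ k ∈ s, F k y) x X = ∑ k ∈ s, dirDeriv (F k) x X := by
  classical
  induction s using Finset.induction_on with
  | empty => simpa using! ⟨mdifferentiableAt_const, dirDeriv_const X (0 : V)⟩
  | insert k s hk ih =>
    simp only [Finset.sum_insert hk]
    exact ⟨(hF k).add ih.1, by rw [dirDeriv_add X (hF k) ih.1, ih.2]⟩

end DirDeriv

variable [IsManifold 𝓘(ℝ, E4) ∞ M]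
  [Bundle.RiemannianBundle (fun x : M => TangentSpace 𝓘(ℝ, E4) x)]
  {S : Type*} [NormedAddCommGroup S] [NormedSpace ℂ S]
  {C : DiracModule S} {ι : Type*} (P : SpinStructure M C ι)
  {cov : AffineConnection M}

namespace SpinStructure

variable {i : ι} {x : M}

theorem sum_connForm_mul (hx : x ∈ P.U i) (μ b : Fin 4) (v : TangentSpace 𝓘(ℝ, E4) x) :
    inner ℝ (cov (P.frame i b) x (P.frame i μ x)) v =
      ∑ a, P.connForm cov i x μ a b * inner ℝ (P.frame i a x) v :=
  (P.sum_inner_frame_mul_inner_frame hx _ _).symm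

theorem inner_cov_frame (hx : x ∈ P.U i) (a b : Fin 4) (X : TangentSpace 𝓘(ℝ, E4) x) :
    inner ℝ (P.frame i a x) (cov (P.frame i b) x X) =
      ∑ μ, inner ℝ (P.frame i μ x) X * P.connForm cov i x μ a b := by
  conv_lhs => rw [← P.sum_inner_smul_frame hx X]
  simp [inner_sum, inner_smul_right, connForm]

/-- The components of the Lie bracket of two vectors of the frame. -/
def structureConst (i : ι) (x : M) (μ ν a : Fin 4) : ℝ :=
  inner ℝ (P.frame i a x) (VectorField.mlieBracket 𝓘(ℝ, E4) (P.frame i μ) (P.frame i ν) x)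

theorem tors_eq (cov : AffineConnection M) (hx : x ∈ P.U i) (a μ ν : Fin 4) :
    P.tors cov i x a μ ν =
      P.connForm cov i x μ a ν - P.connForm cov i x ν a μ - P.structureConst i x μ ν a := by
  rw [tors, CovariantDerivative.torsion_apply (cov := cov) (P.mdifferentiableAt_frame hx μ)
    (P.mdifferentiableAt_frame hx ν)]
  simp [inner_sub_right, connForm, structureConst]

/-- The components `⟨e_a, R(e_τ, e_μ) e_b⟩` of the curvature. -/
def curv (cov : AffineConnection M) (i : ι) (x : M) (τ μ a b : Fin 4) : ℝ :=
  inner ℝ (P.frame i a x)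
    (AffineConnection.curvature cov (P.frame i τ) (P.frame i μ) (P.frame i b) x)

theorem curv_antisymm_left (cov : AffineConnection M) (i : ι) (x : M) (τ μ a b : Fin 4) :
    P.curv cov i x τ μ a b = -P.curv cov i x μ τ a b := by
  rw [curv, curv, ← inner_neg_right, AffineConnection.curvature, AffineConnection.curvature,
    VectorField.mlieBracket_swap_apply]
  congr 1
  simp
  abel

end SpinStructure

variable [IsContMDiffRiemannianBundle 𝓘(ℝ, E4) ∞ E4 (fun x : M => TangentSpace 𝓘(ℝ, E4) x)]

theorem IsMetricConnection.dirDeriv_inner (hcov : IsMetricConnection cov)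
    {Y Z : Π x : M, TangentSpace 𝓘(ℝ, E4) x} {x : M}
    (hY : DiffVectorFieldAt Y x) (hZ : DiffVectorFieldAt Z x) (X : TangentSpace 𝓘(ℝ, E4) x) :
    dirDeriv (fun y => (inner ℝ (Y y) (Z y) : ℝ)) x X =
      inner ℝ (cov Y x X) (Z x) + inner ℝ (Y x) (cov Z x X) := by
  have h := hcov.metric.mvfderiv_inner_eq (FiberBundle.extend E4 X) hY hZ
  simpa using! h

namespace SpinStructure

variable {i : ι} {x : M}

theorem connForm_antisymm (hcov : IsMetricConnection cov) (hx : x ∈ P.U i) (μ a b : Fin 4) :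
    P.connForm cov i x μ a b = -P.connForm cov i x μ b a := by
  have h := hcov.dirDeriv_inner (P.mdifferentiableAt_frame hx a) (P.mdifferentiableAt_frame hx b)
    (P.frame i μ x)
  rw [dirDeriv_congr (g := fun _ => kron a b), dirDeriv_const, real_inner_comm] at h
  · rw [connForm, connForm]
    linarith
  · filter_upwards [P.mem_nhds_U hx] with y hy using P.frame_orthonormal i y hy a b

variable [T2Space M]

theorem smoothVectorFieldAt_cov_frame (hcov : IsMetricConnection cov) (hx : x ∈ P.U i)
    (μ a : Fin 4) : SmoothVectorFieldAt (fun y => cov (P.frame i a) y (P.frame i μ y)) x :=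
  contMDiffAt_cov hcov (P.isOpen_U i) (P.frame_smooth i μ) (P.frame_smooth i a) hx

theorem mdifferentiableAt_connForm (hcov : IsMetricConnection cov) (hx : x ∈ P.U i)
    (μ a b : Fin 4) :
    MDifferentiableAt 𝓘(ℝ, E4) 𝓘(ℝ) (fun y => P.connForm cov i y μ a b) x :=
  ((P.contMDiffAt_frame hx a).inner
    (P.smoothVectorFieldAt_cov_frame hcov hx μ b)).mdifferentiableAt (by simp)

/-- Metric compatibility applied to ⟨e_a, ∇_μ e_ν⟩, solved for the second derivative; the sign of
the product term comes from the skewness of the connection form. -/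
theorem inner_cov_cov_frame (hcov : IsMetricConnection cov) (hx : x ∈ P.U i) (τ μ a ν : Fin 4) :
    inner ℝ (P.frame i a x)
        (cov (fun y => cov (P.frame i ν) y (P.frame i μ y)) x (P.frame i τ x)) =
      dirDeriv (fun y => P.connForm cov i y μ a ν) x (P.frame i τ x) +
        ∑ b, P.connForm cov i x τ a b * P.connForm cov i x μ b ν := by
  have h := hcov.dirDeriv_inner (P.mdifferentiableAt_frame hx a)
    ((P.smoothVectorFieldAt_cov_frame hcov hx μ ν).mdifferentiableAt (by simp)) (P.frame i τ x)
  rw [P.sum_connForm_mul hx] at h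
  change dirDeriv (fun y => P.connForm cov i y μ a ν) x (P.frame i τ x) = _ at h
  rw [h]
  simp only [fun b => P.connForm_antisymm hcov hx τ a b]
  simp [connForm]

/-- Cartan's second structure equation. It expresses the curvature through the connection form and
the bracket coefficients, so that two connections can be compared term by term. -/
theorem curv_eq (hcov : IsMetricConnection cov) (hx : x ∈ P.U i) (τ μ a b : Fin 4) :
    P.curv cov i x τ μ a b =
      dirDeriv (fun y => P.connForm cov i y μ a b) x (P.frame i τ x)
      - dirDeriv (fun y => P.connForm cov i y τ a b) x (P.frame i μ x)
      + ∑ c, (P.connForm cov i x τ a c * P.connForm cov i x μ c b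
        - P.connForm cov i x μ a c * P.connForm cov i x τ c b)
      - ∑ c, P.structureConst i x τ μ c * P.connForm cov i x c a b := by
  rw [curv, AffineConnection.curvature, inner_sub_right, inner_sub_right,
    P.inner_cov_cov_frame hcov hx, P.inner_cov_cov_frame hcov hx, P.inner_cov_frame hx,
    Finset.sum_sub_distrib]
  simp only [structureConst]
  ring

theorem curv_antisymm_right (hcov : IsMetricConnection cov) (hx : x ∈ P.U i) (τ μ a b : Fin 4) :
    P.curv cov i x τ μ a b = -P.curv cov i x τ μ b a := by
  have hd : ∀ μ (X : TangentSpace 𝓘(ℝ, E4) x), dirDeriv (fun y => P.connForm cov i y μ a b) x X =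
      -dirDeriv (fun y => P.connForm cov i y μ b a) x X := by
    intro μ X
    rw [← dirDeriv_neg]
    apply dirDeriv_congr
    filter_upwards [P.mem_nhds_U hx] with y hy using P.connForm_antisymm hcov hy μ a b
  rw [P.curv_eq hcov hx, P.curv_eq hcov hx, hd, hd]
  have h1 : ∀ τ μ, ∑ c, P.connForm cov i x τ a c * P.connForm cov i x μ c b =
      ∑ c, P.connForm cov i x μ b c * P.connForm cov i x τ c a := by
    intro τ μ
    refine Finset.sum_congr rfl fun c _ => ?_
    rw [P.connForm_antisymm hcov hx τ a c, P.connForm_antisymm hcov hx μ c b]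
    ring
  have h2 : ∑ c, P.structureConst i x τ μ c * P.connForm cov i x c a b =
      -∑ c, P.structureConst i x τ μ c * P.connForm cov i x c b a := by
    rw [← Finset.sum_neg_distrib]
    refine Finset.sum_congr rfl fun c _ => ?_
    rw [P.connForm_antisymm hcov hx c a b]
    ring
  simp only [Finset.sum_sub_distrib]
  rw [h1 τ μ, h1 μ τ, h2]
  ring

end SpinStructure

end Connections

/-! ### Symmetry of the Levi-Civita Ricci tensor -/

section LeviCivita

open Filter Topology VectorField

variable {M : Type*} [TopologicalSpace M] [ChartedSpace E4 M] [IsManifold 𝓘(ℝ, E4) ∞ M]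

theorem AffineConnection.map_sub (cov : AffineConnection M)
    {Y Z : Π x : M, TangentSpace 𝓘(ℝ, E4) x} {x : M}
    (hY : DiffVectorFieldAt Y x) (hZ : DiffVectorFieldAt Z x) :
    cov (fun y => Y y - Z y) x = cov Y x - cov Z x := by
  have h := cov.isCovariantDerivativeOnUniv
  have hZ' : DiffVectorFieldAt ((-1 : ℝ) • Z) x := hZ.smul_const_section
  have h1 := h.add hY hZ' trivial
  rw [h.smul_const (-1) hZ trivial] at h1
  have h2 : (fun y => Y y - Z y) = Y + (-1 : ℝ) • Z := by
    ext1 y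
    simp [sub_eq_add_neg]
  rw [h2, h1]
  simp [sub_eq_add_neg]

theorem mlieBracket_jacobi {X Y Z : Π x : M, TangentSpace 𝓘(ℝ, E4) x} {x : M}
    (hX : SmoothVectorFieldAt X x) (hY : SmoothVectorFieldAt Y x) (hZ : SmoothVectorFieldAt Z x) :
    mlieBracket 𝓘(ℝ, E4) X (mlieBracket 𝓘(ℝ, E4) Y Z) x
      + mlieBracket 𝓘(ℝ, E4) Y (mlieBracket 𝓘(ℝ, E4) Z X) x
      + mlieBracket 𝓘(ℝ, E4) Z (mlieBracket 𝓘(ℝ, E4) X Y) x = 0 := by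
  have h3 : IsManifold 𝓘(ℝ, E4) (minSmoothness ℝ 3) M := IsManifold.of_le (n := ∞) (by
    rw [minSmoothness_of_isRCLikeNormedField]; exact WithTop.coe_le_coe.2 le_top)
  have hle : minSmoothness ℝ 2 ≤ ∞ := by
    rw [minSmoothness_of_isRCLikeNormedField]; exact WithTop.coe_le_coe.2 le_top
  rw [leibniz_identity_mlieBracket_apply (hX.of_le hle) (hY.of_le hle) (hZ.of_le hle),
    mlieBracket_swap (V := mlieBracket 𝓘(ℝ, E4) X Y) (W := Z),
    mlieBracket_swap (V := X) (W := Z)]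
  have h0 : mlieBracket 𝓘(ℝ, E4) Y (-mlieBracket 𝓘(ℝ, E4) Z X) x =
      -mlieBracket 𝓘(ℝ, E4) Y (mlieBracket 𝓘(ℝ, E4) Z X) x := by
    have hm : IsManifold 𝓘(ℝ, E4) (((2 : ℕ∞) : ℕ∞ω) + 1) M :=
      IsManifold.of_le (n := ∞) (WithTop.coe_le_coe.2 le_top)
    have hd : DiffVectorFieldAt (mlieBracket 𝓘(ℝ, E4) Z X) x :=
      (ContMDiffAt.mlieBracket_vectorField (m := 1) (n := 2)
        (hZ.of_le (WithTop.coe_le_coe.2 le_top)) (hX.of_le (WithTop.coe_le_coe.2 le_top))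
        (by rw [minSmoothness_of_isRCLikeNormedField]; norm_num)).mdifferentiableAt (by simp)
    simpa using mlieBracket_const_smul_right (V := Y) (c := (-1 : ℝ)) hd
  rw [h0]
  simp

variable [Bundle.RiemannianBundle (fun x : M => TangentSpace 𝓘(ℝ, E4) x)]
  [IsContMDiffRiemannianBundle 𝓘(ℝ, E4) ∞ E4 (fun x : M => TangentSpace 𝓘(ℝ, E4) x)]
  {S : Type*} [NormedAddCommGroup S] [NormedSpace ℂ S]
  {C : DiracModule S} {ι : Type*} (P : SpinStructure M C ι)
  {lc : AffineConnection M}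

theorem IsLeviCivita.mlieBracket_eq (hlc : IsLeviCivita lc)
    {X Y : Π x : M, TangentSpace 𝓘(ℝ, E4) x} {x : M}
    (hX : DiffVectorFieldAt X x) (hY : DiffVectorFieldAt Y x) :
    mlieBracket 𝓘(ℝ, E4) X Y x = lc Y x (X x) - lc X x (Y x) :=
  ((CovariantDerivative.torsion_eq_zero_iff (cov := lc)).1 hlc.torsion_free hX hY).symm

variable [T2Space M]

/-- The covariant derivative of a commutator, for the Levi-Civita connection. -/
theorem IsLeviCivita.cov_cov_sub (hlc : IsLeviCivita lc)
    {X Y Z : Π x : M, TangentSpace 𝓘(ℝ, E4) x} {u : Set M} (hu : IsOpen u)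
    (hX : SmoothVectorFieldOn X u) (hY : SmoothVectorFieldOn Y u) (hZ : SmoothVectorFieldOn Z u)
    {x : M} (hx : x ∈ u) :
    lc (fun y => lc Z y (Y y)) x (X x) - lc (fun y => lc Y y (Z y)) x (X x)
      - lc X x (mlieBracket 𝓘(ℝ, E4) Y Z x) =
    mlieBracket 𝓘(ℝ, E4) X (mlieBracket 𝓘(ℝ, E4) Y Z) x := by
  have hd {V : Π x : M, TangentSpace 𝓘(ℝ, E4) x} (hV : SmoothVectorFieldOn V u) {y : M}
      (hy : y ∈ u) : DiffVectorFieldAt V y :=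
    (hV.contMDiffAt (hu.mem_nhds hy)).mdifferentiableAt (by simp)
  have h1 := (contMDiffAt_cov hlc.toIsMetricConnection hu hY hZ hx).mdifferentiableAt (by simp)
  have h2 := (contMDiffAt_cov hlc.toIsMetricConnection hu hZ hY hx).mdifferentiableAt (by simp)
  have heq : ∀ᶠ y in 𝓝 x, lc Z y (Y y) - lc Y y (Z y) = mlieBracket 𝓘(ℝ, E4) Y Z y := by
    filter_upwards [hu.mem_nhds hx] with y hy
    rw [hlc.mlieBracket_eq (hd hY hy) (hd hZ hy)]
  have h3 : DiffVectorFieldAt (fun y => lc Z y (Y y) - lc Y y (Z y)) x :=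
    mdifferentiableAt_sub_section h1 h2
  have h4 : DiffVectorFieldAt (mlieBracket 𝓘(ℝ, E4) Y Z) x := by
    refine h3.congr_of_eventuallyEq ?_
    filter_upwards [heq] with y hy
    rw [hy]
  rw [hlc.mlieBracket_eq (hd hX hx) h4, ← lc.isCovariantDerivativeOn.congr_of_eventuallyEq
    (s := Set.univ) h3 h4 univ_mem heq, AffineConnection.map_sub lc h1 h2]
  simp

/-- With vanishing torsion the cyclic sum of curvatures regroups, by `cov_cov_sub`, into the cyclic
sum of double brackets, which is zero by the Jacobi identity. -/
theorem IsLeviCivita.bianchi (hlc : IsLeviCivita lc)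
    {X Y Z : Π x : M, TangentSpace 𝓘(ℝ, E4) x} {u : Set M} (hu : IsOpen u)
    (hX : SmoothVectorFieldOn X u) (hY : SmoothVectorFieldOn Y u) (hZ : SmoothVectorFieldOn Z u)
    {x : M} (hx : x ∈ u) :
    AffineConnection.curvature lc X Y Z x + AffineConnection.curvature lc Y Z X x
      + AffineConnection.curvature lc Z X Y x = 0 := by
  rw [← mlieBracket_jacobi (hX.contMDiffAt (hu.mem_nhds hx)) (hY.contMDiffAt (hu.mem_nhds hx))
    (hZ.contMDiffAt (hu.mem_nhds hx)), ← hlc.cov_cov_sub hu hX hY hZ hx,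
    ← hlc.cov_cov_sub hu hY hZ hX hx, ← hlc.cov_cov_sub hu hZ hX hY hx]
  simp only [AffineConnection.curvature]
  abel

namespace SpinStructure

variable {i : ι} {x : M}

theorem curv_bianchi (hlc : IsLeviCivita lc) (hx : x ∈ P.U i) (a b c d : Fin 4) :
    P.curv lc i x a b d c + P.curv lc i x b c d a + P.curv lc i x c a d b = 0 := by
  simp only [curv]
  rw [← inner_add_right, ← inner_add_right, hlc.bianchi (P.isOpen_U i) (P.frame_smooth i a)
    (P.frame_smooth i b) (P.frame_smooth i c) hx, inner_zero_right]

theorem curv_pair_symm (hlc : IsLeviCivita lc) (hx : x ∈ P.U i) (a b c d : Fin 4) :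
    P.curv lc i x a b c d = P.curv lc i x c d a b := by
  have B := P.curv_bianchi hlc hx
  have L := P.curv_antisymm_left lc i x
  have R := P.curv_antisymm_right hlc.toIsMetricConnection hx
  -- The octahedron argument: the four Bianchi identities, each holding one index outside the cycle,
  -- are combined using the antisymmetry in each pair.
  linarith [B a b c d, B b c d a, B c d a b, B d a b c, L a b c d, L b c d a, L c d a b, L d a b c,
    R a b c d, R b c d a, R c d a b, R d a b c, R a b d c, R b c a d, R c d b a, R d a c b,
    L a c b d, L b d a c, L c a d b, L d b c a, R a c b d, R b d a c, R c a d b, R d b c a,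
    R a c d b, R b d c a]

theorem ric_symm (hlc : IsLeviCivita lc) (hx : x ∈ P.U i) (μ ν : Fin 4) :
    P.ric lc i x μ ν = P.ric lc i x ν μ :=
  Finset.sum_congr rfl fun τ _ => P.curv_pair_symm hlc hx τ μ τ ν

end SpinStructure

end LeviCivita

/-! ### Algebra of an axial contorsion -/

theorem levi_swap_left (a b c d : Fin 4) : levi b a c d = -levi a b c d := by
  simp only [levi_eq_vandermonde]; ring

theorem levi_swap_mid (a b c d : Fin 4) : levi a c b d = -levi a b c d := by
  simp only [levi_eq_vandermonde]; ring

theorem levi_swap_right (a b c d : Fin 4) : levi a b d c = -levi a b c d := by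
  simp only [levi_eq_vandermonde]; ring

theorem levi_self_mid (a b c : Fin 4) : levi a b b c = 0 := by
  simp [levi_eq_vandermonde]

theorem levi_self_outer (a b c : Fin 4) : levi a b c b = 0 := by
  simp [levi_eq_vandermonde]

theorem sum_levi_mul_levi (a b c d : Fin 4) :
    ∑ s, ∑ t, levi a b s t * levi c d s t =
      2 * (kron a c * kron b d - kron a d * kron b c) := by
  -- The identity over the integers, where it is decidable; each symbol is scaled by 12, whence 288
  -- = 2 · 12².
  have h : ∀ a b c d : Fin 4, ∑ s : Fin 4, ∑ t : Fin 4,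
      ((((b : ℕ) : ℤ) - (a : ℕ)) * (((s : ℕ) : ℤ) - (a : ℕ)) * (((t : ℕ) : ℤ) - (a : ℕ)) *
        (((s : ℕ) : ℤ) - (b : ℕ)) * (((t : ℕ) : ℤ) - (b : ℕ)) * (((t : ℕ) : ℤ) - (s : ℕ))) *
      ((((d : ℕ) : ℤ) - (c : ℕ)) * (((s : ℕ) : ℤ) - (c : ℕ)) * (((t : ℕ) : ℤ) - (c : ℕ)) *
        (((s : ℕ) : ℤ) - (d : ℕ)) * (((t : ℕ) : ℤ) - (d : ℕ)) * (((t : ℕ) : ℤ) - (s : ℕ))) =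
      288 * ((if a = c then 1 else 0) * (if b = d then 1 else 0)
        - (if a = d then 1 else 0) * (if b = c then 1 else 0)) := by
    decide +kernel
  have h' := congrArg (fun z : ℤ => (z : ℝ) / 144) (h a b c d)
  simp only [levi_eq_vandermonde, kron]
  push_cast [Finset.sum_div] at h'
  convert h' using 1
  · exact Finset.sum_congr rfl fun _ _ => Finset.sum_congr rfl fun _ _ => by ring
  · ring

section Algebra
variable (w : Fin 4 → Fin 4 → Fin 4 → ℝ) (A : Fin 4 → ℝ) (μ ν : Fin 4)

/-- The part of the Ricci contraction quadratic in the contorsion. -/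
theorem axial_contorsion_quadratic :
    ∑ τ, ∑ c, (∑ ξ, A ξ * levi ξ τ μ c) * (∑ ξ, A ξ * levi ξ c τ ν) =
      2 * ((∑ ξ, A ξ * A ξ) * kron μ ν - A μ * A ν) := by
  fin_cases μ <;> fin_cases ν <;>
    simp [Fin.sum_univ_four, levi_eq_vandermonde, kron] <;> ring

-- The cross terms of connection form and contorsion in the Ricci contraction, with the bracket
-- coefficients written as w τ c μ - w μ c τ. Only those completing the derivatives of A to the
-- exterior derivative survive.
set_option maxHeartbeats 2000000 in
theorem axial_contorsion_linear (hw : ∀ μ a b, w μ a b = -w μ b a) :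
    ∑ τ, ∑ c, (w τ τ c * (∑ ξ, A ξ * levi ξ c μ ν) - w μ τ c * (∑ ξ, A ξ * levi ξ c τ ν)
      - (∑ ξ, A ξ * levi ξ τ μ c) * w τ c ν
      - (w τ c μ - w μ c τ) * (∑ ξ, A ξ * levi ξ τ c ν)) =
      (1 / 2) * ∑ a, ∑ b, levi a b μ ν * ∑ c, A c * (w a c b - w b c a) := by
  have h0 : ∀ μ a, w μ a a = 0 := fun μ a => by linarith [hw μ a a]
  have h10 := fun μ => hw μ 1 0
  have h20 := fun μ => hw μ 2 0
  have h30 := fun μ => hw μ 3 0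
  have h21 := fun μ => hw μ 2 1
  have h31 := fun μ => hw μ 3 1
  have h32 := fun μ => hw μ 3 2
  clear hw
  fin_cases μ <;> fin_cases ν <;>
    simp [Fin.sum_univ_four, levi_eq_vandermonde, h0, h10, h20, h30, h21, h31, h32] <;> ring

end Algebra

theorem sum_mul_levi_eq_neg (D : Fin 4 → Fin 4 → ℝ) (μ ν : Fin 4) :
    ∑ τ, ∑ ξ, D τ ξ * levi ξ τ μ ν =
      -((1 / 2) * ∑ a, ∑ b, levi a b μ ν * (D a b - D b a)) := by
  have h1 : ∑ τ, ∑ ξ, D τ ξ * levi ξ τ μ ν = -∑ a, ∑ b, levi a b μ ν * D a b := by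
    simp only [← Finset.sum_neg_distrib]
    exact Finset.sum_congr rfl fun a _ => Finset.sum_congr rfl fun b _ => by
      rw [levi_swap_left]; ring
  have h2 : ∑ a, ∑ b, levi a b μ ν * D b a = ∑ τ, ∑ ξ, D τ ξ * levi ξ τ μ ν := by
    rw [Finset.sum_comm]
    exact Finset.sum_congr rfl fun a _ => Finset.sum_congr rfl fun b _ => mul_comm _ _
  simp only [mul_sub, Finset.sum_sub_distrib]
  rw [h2, h1]
  ring

/-! ### Ricci and scalar curvature of a connection with axial torsion -/

section Contorsion

open Filter Topology

variable {M : Type*} [TopologicalSpace M] [ChartedSpace E4 M]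
  [IsManifold 𝓘(ℝ, E4) ∞ M]
  [Bundle.RiemannianBundle (fun x : M => TangentSpace 𝓘(ℝ, E4) x)]
  {S : Type*} [NormedAddCommGroup S] [NormedSpace ℂ S]
  {C : DiracModule S} {ι : Type*} {P : SpinStructure M C ι}
  {cov lc : AffineConnection M} {A : Π x : M, TangentSpace 𝓘(ℝ, E4) x} {i : ι} {x : M}

namespace SpinStructure

/-- The difference of two connections is tensorial, so it suffices to compare on frame vectors. -/
theorem hasHalfTorsionContorsion_of_connForm
    (h : ∀ x, ∃ i, x ∈ P.U i ∧ ∀ μ a b, P.connForm cov i x μ a b =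
      P.connForm lc i x μ a b + (1 / 2) * P.tors cov i x a μ b) :
    HasHalfTorsionContorsion cov lc := by
  intro x Y hY X
  obtain ⟨i, hx, hi⟩ := h x
  have key : ∀ b μ, CovariantDerivative.difference cov lc x (P.frame i b x) (P.frame i μ x) =
      (1 / 2 : ℝ) • cov.torsion x (P.frame i μ x) (P.frame i b x) := by
    intro b μ
    rw [CovariantDerivative.difference,
      IsCovariantDerivativeOn.difference_apply _ _ (Set.mem_univ x)
        (P.mdifferentiableAt_frame hx b)]
    refine P.ext_inner_frame hx fun a => ?_
    have := hi μ a b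
    simp only [connForm, tors] at this
    simp only [sub_apply, inner_sub_right, inner_smul_right, this]
    ring
  have h2 : CovariantDerivative.difference cov lc x (Y x) X =
      (1 / 2 : ℝ) • cov.torsion x X (Y x) := by
    conv_lhs => rw [← P.sum_inner_smul_frame hx X, ← P.sum_inner_smul_frame hx (Y x)]
    conv_rhs => rw [← P.sum_inner_smul_frame hx X, ← P.sum_inner_smul_frame hx (Y x)]
    simp only [map_sum, map_smul, sum_apply, smul_apply,
      key, Finset.smul_sum]
    rw [Finset.sum_comm]
    refine Finset.sum_congr rfl fun _ _ => Finset.sum_congr rfl fun _ _ => ?_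
    module
  rw [← h2, CovariantDerivative.difference,
      IsCovariantDerivativeOn.difference_apply _ _ (Set.mem_univ x) hY]
  simp

variable [IsContMDiffRiemannianBundle 𝓘(ℝ, E4) ∞ E4 (fun x : M => TangentSpace 𝓘(ℝ, E4) x)]

theorem structureConst_eq (hlc : IsLeviCivita lc) (hx : x ∈ P.U i) (μ ν a : Fin 4) :
    P.structureConst i x μ ν a = P.connForm lc i x μ a ν - P.connForm lc i x ν a μ := by
  have h : P.tors lc i x a μ ν = 0 := by simp [tors, hlc.torsion_free]
  rw [P.tors_eq lc hx] at h
  linarith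

theorem mdifferentiableAt_comp (hA : SmoothVectorFieldOn A Set.univ) (hx : x ∈ P.U i)
    (a : Fin 4) : MDifferentiableAt 𝓘(ℝ, E4) 𝓘(ℝ) (fun y => P.comp A i y a) x :=
  (P.mdifferentiableAt_frame hx a).inner
    ((hA.contMDiffAt Filter.univ_mem).mdifferentiableAt (by simp))

theorem extD_eq (hlc : IsLeviCivita lc) (hx : x ∈ P.U i) (a b : Fin 4) :
    P.extD A i x a b = dirDeriv (fun y => P.comp A i y b) x (P.frame i a x)
      - dirDeriv (fun y => P.comp A i y a) x (P.frame i b x)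
      - ∑ c, P.comp A i x c * (P.connForm lc i x a c b - P.connForm lc i x b c a) := by
  rw [extD, ← P.sum_inner_frame_mul_inner_frame hx (A x)]
  simp only [← structureConst_eq hlc hx]
  rfl

/-- A metric connection with axial torsion differs from the Levi-Civita connection by half of the
torsion. -/
theorem HasAxialTorsion.connForm_eq (hA : P.HasAxialTorsion cov A) (hlc : IsLeviCivita lc)
    (hcov : IsMetricConnection cov) (hx : x ∈ P.U i) (μ a b : Fin 4) :
    P.connForm cov i x μ a b =
      P.connForm lc i x μ a b + (1 / 2) * ∑ ξ, P.comp A i x ξ * levi ξ a μ b := by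
  have h : ∀ τ μ ν, ∑ ξ, P.comp A i x ξ * levi ξ τ μ ν =
      P.connForm cov i x μ τ ν - P.connForm cov i x ν τ μ
        - (P.connForm lc i x μ τ ν - P.connForm lc i x ν τ μ) := by
    intro τ μ ν
    rw [← hA i x hx, P.tors_eq cov hx, structureConst_eq hlc hx]
  have s1 : ∑ ξ, P.comp A i x ξ * levi ξ b a μ = ∑ ξ, P.comp A i x ξ * levi ξ a μ b :=
    Finset.sum_congr rfl fun ξ _ => by rw [levi_swap_mid, levi_swap_right]; ring
  have s2 : ∑ ξ, P.comp A i x ξ * levi ξ μ a b = -∑ ξ, P.comp A i x ξ * levi ξ a μ b := by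
    rw [← Finset.sum_neg_distrib]
    exact Finset.sum_congr rfl fun ξ _ => by rw [levi_swap_mid]; ring
  -- As in the Koszul formula: three permutations of the torsion equation and skewness in the last
  -- two indices determine the connection form.
  have e1 := h a μ b
  have e2 := h b a μ
  have e3 := h μ a b
  have c := P.connForm_antisymm hcov hx
  have l := P.connForm_antisymm hlc.toIsMetricConnection hx
  linarith [c μ a b, c a b μ, c b a μ, l μ a b, l a b μ, l b a μ]

variable [T2Space M]

theorem HasAxialTorsion.dirDeriv_connForm (hA : P.HasAxialTorsion cov A) (hlc : IsLeviCivita lc)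
    (hcov : IsMetricConnection cov) (hAs : SmoothVectorFieldOn A Set.univ) (hx : x ∈ P.U i)
    (μ a b : Fin 4) (X : TangentSpace 𝓘(ℝ, E4) x) :
    dirDeriv (fun y => P.connForm cov i y μ a b) x X =
      dirDeriv (fun y => P.connForm lc i y μ a b) x X
        + (1 / 2) * ∑ ξ, dirDeriv (fun y => P.comp A i y ξ) x X * levi ξ a μ b := by
  have hd : ∀ ξ, MDifferentiableAt 𝓘(ℝ, E4) 𝓘(ℝ)
      (fun y => ((1 / 2) * levi ξ a μ b) • P.comp A i y ξ) x :=
    fun ξ => (mdifferentiableAt_comp hAs hx ξ).const_smul _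
  have hs := dirDeriv_sum X Finset.univ hd
  rw [dirDeriv_congr (g := fun y => P.connForm lc i y μ a b +
    ∑ ξ, ((1 / 2) * levi ξ a μ b) • P.comp A i y ξ), dirDeriv_add X
    (P.mdifferentiableAt_connForm hlc.toIsMetricConnection hx μ a b) hs.1, hs.2]
  · congr 1
    rw [Finset.mul_sum]
    refine Finset.sum_congr rfl fun ξ _ => ?_
    rw [dirDeriv_const_smul X _ (mdifferentiableAt_comp hAs hx ξ), smul_eq_mul]
    ring
  · filter_upwards [P.mem_nhds_U hx] with y hy
    rw [hA.connForm_eq hlc hcov hy, Finset.mul_sum]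
    congr 1
    exact Finset.sum_congr rfl fun ξ _ => by rw [smul_eq_mul]; ring

/-- The Ricci curvature of a metric connection with axial torsion. -/
theorem HasAxialTorsion.ric_eq (hA : P.HasAxialTorsion cov A) (hlc : IsLeviCivita lc)
    (hcov : IsMetricConnection cov) (hAs : SmoothVectorFieldOn A Set.univ) (hx : x ∈ P.U i)
    (μ ν : Fin 4) :
    P.ric cov i x μ ν = P.ric lc i x μ ν - (1 / 2) * P.starExtD A i x μ ν
      - (1 / 2) * (P.sqLength A i x * kron μ ν - P.comp A i x μ * P.comp A i x ν) := by
  have hl := axial_contorsion_linear (P.connForm lc i x) (P.comp A i x) μ ν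
    (P.connForm_antisymm hlc.toIsMetricConnection hx)
  have hq := axial_contorsion_quadratic (P.comp A i x) μ ν
  have hD : ∑ τ, ∑ ξ, dirDeriv (fun y => P.comp A i y ξ) x (P.frame i τ x) * levi ξ τ μ ν =
      -((1 / 2) * ∑ a, ∑ b, levi a b μ ν * (dirDeriv (fun y => P.comp A i y b) x (P.frame i a x)
        - dirDeriv (fun y => P.comp A i y a) x (P.frame i b x))) :=
    sum_mul_levi_eq_neg (fun a b => dirDeriv (fun y => P.comp A i y b) x (P.frame i a x)) μ ν
  have hst : P.starExtD A i x μ ν =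
      (1 / 2) * (∑ a, ∑ b, levi a b μ ν * (dirDeriv (fun y => P.comp A i y b) x (P.frame i a x)
        - dirDeriv (fun y => P.comp A i y a) x (P.frame i b x)))
      - (1 / 2) * ∑ a, ∑ b, levi a b μ ν * ∑ c, P.comp A i x c *
        (P.connForm lc i x a c b - P.connForm lc i x b c a) := by
    simp only [starExtD, extD_eq hlc hx, mul_sub, Finset.sum_sub_distrib]
  -- For both connections the bracket coefficients are written with the Levi-Civita form, so they
  -- match when the Ricci tensors are subtracted.
  have hric : ∀ {c : AffineConnection M}, IsMetricConnection c → P.ric c i x μ ν =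
      ∑ τ, (dirDeriv (fun y => P.connForm c i y μ τ ν) x (P.frame i τ x)
      - dirDeriv (fun y => P.connForm c i y τ τ ν) x (P.frame i μ x)
      + ∑ d, (P.connForm c i x τ τ d * P.connForm c i x μ d ν
        - P.connForm c i x μ τ d * P.connForm c i x τ d ν)
      - ∑ d, (P.connForm lc i x τ d μ - P.connForm lc i x μ d τ) * P.connForm c i x d τ ν) := by
    intro c hc
    simp only [← structureConst_eq hlc hx, ← P.curv_eq hc hx]
    rfl
  have hdiff : P.ric cov i x μ ν - P.ric lc i x μ ν =
      (1 / 2) * ∑ τ, ∑ ξ, dirDeriv (fun y => P.comp A i y ξ) x (P.frame i τ x) * levi ξ τ μ ν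
      + (1 / 2) * ∑ τ, ∑ c, (P.connForm lc i x τ τ c * (∑ ξ, P.comp A i x ξ * levi ξ c μ ν)
          - P.connForm lc i x μ τ c * (∑ ξ, P.comp A i x ξ * levi ξ c τ ν)
          - (∑ ξ, P.comp A i x ξ * levi ξ τ μ c) * P.connForm lc i x τ c ν
          - (P.connForm lc i x τ c μ - P.connForm lc i x μ c τ) *
            (∑ ξ, P.comp A i x ξ * levi ξ τ c ν))
      - (1 / 4) * ∑ τ, ∑ c, (∑ ξ, P.comp A i x ξ * levi ξ τ μ c) *
          (∑ ξ, P.comp A i x ξ * levi ξ c τ ν) := by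
    rw [hric hcov, hric hlc.toIsMetricConnection]
    -- The traced contorsion vanishes by antisymmetry (`levi_self_mid`); this removes the second
    -- derivative term and one of the two quadratic terms.
    simp only [hA.dirDeriv_connForm hlc hcov hAs hx, hA.connForm_eq hlc hcov hx, levi_self_mid,
      mul_zero, Finset.sum_const_zero, add_zero]
    rw [Finset.mul_sum, Finset.mul_sum, Finset.mul_sum, ← Finset.sum_sub_distrib,
      ← Finset.sum_add_distrib, ← Finset.sum_sub_distrib]
    obtain ⟨k, hk⟩ : ∃ k : Fin 4 → Fin 4 → Fin 4 → ℝ, ∀ a b c,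
        ∑ ξ, P.comp A i x ξ * levi ξ a b c = k a b c := ⟨_, fun _ _ _ => rfl⟩
    obtain ⟨e, he⟩ : ∃ e : Fin 4 → ℝ, ∀ τ, ∑ ξ, dirDeriv (fun y => P.comp A i y ξ) x
        (P.frame i τ x) * levi ξ τ μ ν = e τ := ⟨_, fun _ => rfl⟩
    simp only [hk, he]
    refine Finset.sum_congr rfl fun τ _ => ?_
    simp only [Fin.sum_univ_four]
    ring
  rw [hl, hq, hD] at hdiff
  rw [hst, sqLength]
  linarith

/-- The trace of |A|²g - A⊗A is (4 - 1)|A|², and ⋆dA has zero diagonal. -/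
theorem HasAxialTorsion.scal_eq (hA : P.HasAxialTorsion cov A) (hlc : IsLeviCivita lc)
    (hcov : IsMetricConnection cov) (hAs : SmoothVectorFieldOn A Set.univ) (hx : x ∈ P.U i) :
    P.scal cov i x = P.scal lc i x - (3 / 2) * P.sqLength A i x := by
  have h0 : ∀ μ, P.starExtD A i x μ μ = 0 := fun μ => by simp [starExtD, levi_eq_vandermonde]
  simp only [scal, hA.ric_eq hlc hcov hAs hx, h0, Finset.sum_sub_distrib, ← Finset.mul_sum, kron]
  simp [sqLength]
  ring

end SpinStructure

end Contorsion

/-! ### Action of the axial contorsion on spinors -/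

namespace DiracModule

variable {S : Type*} [NormedAddCommGroup S] [NormedSpace ℂ S] (C : DiracModule S)

/-- The action `k_{ab} γ_a γ_b` of a bivector on spinors. -/
def bivec (k : Fin 4 → Fin 4 → ℝ) : S →L[ℂ] S := ∑ a, ∑ b, ((k a b : ℝ) : ℂ) • (C.γ a * C.γ b)

theorem bivec_swap {k : Fin 4 → Fin 4 → ℝ} (hk : ∀ a b, k b a = -k a b) :
    ∑ a, ∑ b, ((k a b : ℝ) : ℂ) • (C.γ b * C.γ a) = -C.bivec k := by
  rw [Finset.sum_comm, bivec]
  simp only [← Finset.sum_neg_distrib]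
  exact Finset.sum_congr rfl fun a _ => Finset.sum_congr rfl fun b _ => by rw [hk a b]; simp

/-- The two signs from moving γ_a and γ_b across cancel, and the reversal of their order gives the
minus sign. -/
theorem form_bivec_left {k : Fin 4 → Fin 4 → ℝ} (hk : ∀ a b, k b a = -k a b) (s t : S) :
    C.form (C.bivec k s) t = -C.form s (C.bivec k t) := by
  have h : -C.form s (C.bivec k t) =
      C.form s ((∑ a, ∑ b, ((k a b : ℝ) : ℂ) • (C.γ b * C.γ a)) t) := by
    rw [C.bivec_swap hk]
    simp
  rw [h, bivec]
  simp [C.form_skew, -Complex.coe_smul]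

/-- Skewness replaces γ_aγ_b by ½[γ_a, γ_b], which brings in `clifford_triple`. -/
theorem γ_mul_bivec_add (k : Fin 4 → Fin 4 → ℝ) (hk : ∀ a b, k b a = -k a b) (c : Fin 4) :
    C.γ c * C.bivec k + C.bivec k * C.γ c =
      ∑ r, ((-2 * ∑ a, ∑ b, k a b * levi r c a b : ℝ) : ℂ) • (C.γ r * C.γ5) := by
  have h1 : C.bivec k = (1 / 2 : ℂ) •
      ∑ a, ∑ b, ((k a b : ℝ) : ℂ) • (C.γ a * C.γ b - C.γ b * C.γ a) := by
    simp only [smul_sub, Finset.sum_sub_distrib]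
    rw [C.bivec_swap hk, ← bivec]
    module
  rw [h1]
  have h2 : ∀ a b, C.γ c * (C.γ a * C.γ b - C.γ b * C.γ a)
      + (C.γ a * C.γ b - C.γ b * C.γ a) * C.γ c =
      ∑ r, ((-4 * levi r c a b : ℝ) : ℂ) • (C.γ r * C.γ5) := by
    intro a b
    rw [add_comm, clifford_triple C.clifford a b c]
    refine Finset.sum_congr rfl fun r _ => ?_
    -- Four transpositions: the cyclic move from c a b to a b c is even.
    rw [levi_swap_right r c b a, levi_swap_mid r b c a, levi_swap_right r b a c,
      levi_swap_mid r a b c]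
    simp [γ5]
  simp only [mul_smul_comm, smul_mul_assoc, Finset.mul_sum, Finset.sum_mul,
    ← Finset.sum_add_distrib, ← smul_add, h2]
  simp only [Complex.ofReal_sum, Finset.sum_smul, Finset.smul_sum]
  rw [Finset.sum_congr rfl fun a _ => Finset.sum_comm, Finset.sum_comm]
  refine Finset.sum_congr rfl fun r _ => Finset.sum_congr rfl fun a _ =>
    Finset.sum_congr rfl fun b _ => ?_
  push_cast
  module

/-- In every nonzero term γ_c passes two generators different from itself, so the signs cancel. -/
theorem γ_mul_bivec_comm {k : Fin 4 → Fin 4 → ℝ} {c : Fin 4} (h1 : ∀ a, k c a = 0)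
    (h2 : ∀ a, k a c = 0) : C.γ c * C.bivec k = C.bivec k * C.γ c := by
  simp only [bivec, Finset.mul_sum, Finset.sum_mul, mul_smul_comm, smul_mul_assoc]
  refine Finset.sum_congr rfl fun a _ => Finset.sum_congr rfl fun b _ => ?_
  by_cases ha : a = c
  · subst ha; simp [h1]
  by_cases hb : b = c
  · subst hb; simp [h2]
  have hab : ∀ d, d ≠ c → C.γ c * C.γ d = -(C.γ d * C.γ c) := by
    intro d hd
    have h := C.clifford c d
    simp only [kron, if_neg (Ne.symm hd)] at h
    exact eq_neg_of_add_eq_zero_left (by simpa using h)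
  rw [← mul_assoc, hab a ha, neg_mul, mul_assoc, hab b hb, mul_neg, neg_neg, mul_assoc]

/-- The bivector `A^ξ ε_{ξμab}`. -/
def axialBivec (A : Fin 4 → ℝ) (μ a b : Fin 4) : ℝ := ∑ ξ, A ξ * levi ξ μ a b

theorem axialBivec_swap (A : Fin 4 → ℝ) (μ a b : Fin 4) :
    axialBivec A μ b a = -axialBivec A μ a b := by
  simp only [axialBivec, ← Finset.sum_neg_distrib]
  exact Finset.sum_congr rfl fun ξ _ => by rw [levi_swap_right]; ring

theorem γ_mul_axialBivec_add (A : Fin 4 → ℝ) (μ ν : Fin 4) :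
    C.γ μ * C.bivec (axialBivec A ν) + C.bivec (axialBivec A ν) * C.γ μ =
      (-4 : ℂ) • ((kron μ ν : ℂ) • ∑ ξ, ((A ξ : ℝ) : ℂ) • (C.γ ξ * C.γ5)
        - ((A μ : ℝ) : ℂ) • (C.γ ν * C.γ5)) := by
  have h : ∀ r, ∑ a, ∑ b, axialBivec A ν a b * levi r μ a b =
      2 * (kron μ ν * A r - A μ * kron ν r) := by
    intro r
    have h1 : ∑ a, ∑ b, axialBivec A ν a b * levi r μ a b =
        ∑ ξ, A ξ * ∑ a, ∑ b, levi ξ ν a b * levi r μ a b := by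
      simp only [axialBivec, Finset.sum_mul, Finset.mul_sum, mul_assoc]
      rw [Finset.sum_comm]
      simp only [fun b => Finset.sum_comm (s := (Finset.univ : Finset (Fin 4))) (t := Finset.univ)
        (f := fun a ξ => A ξ * (levi ξ ν a b * levi r μ a b))]
      rw [Finset.sum_comm]
      exact Finset.sum_congr rfl fun _ _ => Finset.sum_comm
    rw [h1]
    simp only [sum_levi_mul_levi, kron, mul_sub, Finset.sum_sub_distrib]
    simp
    by_cases hμν : μ = ν
    · subst hμν; simp; split_ifs <;> ring
    · simp [hμν, Ne.symm hμν]; split_ifs <;> ring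
  rw [C.γ_mul_bivec_add _ (axialBivec_swap A ν)]
  simp only [h, Finset.smul_sum, smul_sub]
  have h3 : ((A μ : ℝ) : ℂ) • (C.γ ν * C.γ5) =
      ∑ r, ((A μ * kron ν r : ℝ) : ℂ) • (C.γ r * C.γ5) := by
    simp [kron]
  rw [h3, Finset.smul_sum, ← Finset.sum_sub_distrib]
  refine Finset.sum_congr rfl fun r _ => ?_
  push_cast
  module

/-- The bivector ε_{ξμab}A^ξ does not involve γ_μ, hence commutes with it, and the product is half
of the anticommutator in `γ_mul_axialBivec_add`. Summing over μ gives -2(4 - 1) = -6. -/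
theorem sum_γ_mul_axialBivec (A : Fin 4 → ℝ) :
    ∑ μ, C.γ μ * C.bivec (axialBivec A μ) =
      (-6 : ℂ) • ∑ ξ, ((A ξ : ℝ) : ℂ) • (C.γ ξ * C.γ5) := by
  have h : ∀ μ, C.γ μ * C.bivec (axialBivec A μ) =
      (-2 : ℂ) • (∑ ξ, ((A ξ : ℝ) : ℂ) • (C.γ ξ * C.γ5) - ((A μ : ℝ) : ℂ) • (C.γ μ * C.γ5)) := by
    intro μ
    have h1 := C.γ_mul_axialBivec_add A μ μ
    rw [← C.γ_mul_bivec_comm (k := axialBivec A μ) (c := μ)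
      (fun a => by simp [axialBivec, levi_self_mid])
      (fun a => by simp [axialBivec, levi_self_outer])] at h1
    have h2 : C.γ μ * C.bivec (axialBivec A μ) =
        (1 / 2 : ℂ) • (C.γ μ * C.bivec (axialBivec A μ) + C.γ μ * C.bivec (axialBivec A μ)) := by
      module
    rw [h2, h1]
    simp only [kron, if_true, Complex.ofReal_one, one_smul]
    module
  simp only [h, ← Finset.smul_sum, Finset.sum_sub_distrib, Finset.sum_const, Finset.card_univ,
    Fintype.card_fin]
  module

end DiracModule

theorem DiracModule.mul_apply {S : Type*} [NormedAddCommGroup S] [NormedSpace ℂ S]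
    (f g : S →L[ℂ] S) (s : S) : (f * g) s = f (g s) := rfl

theorem DiracModule.form_smul_left {S : Type*} [NormedAddCommGroup S] [NormedSpace ℂ S]
    (C : DiracModule S) (z : ℂ) (s t : S) : C.form (z • s) t = starRingEnd ℂ z * C.form s t := by
  simp

/-! ### Comparison of the two systems of equations -/

section SpinorEquations

variable {M : Type*} [TopologicalSpace M] [ChartedSpace E4 M]
  [IsManifold 𝓘(ℝ, E4) ∞ M]
  [Bundle.RiemannianBundle (fun x : M => TangentSpace 𝓘(ℝ, E4) x)]
  {S : Type*} [NormedAddCommGroup S] [NormedSpace ℂ S]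
  {C : DiracModule S} {ι : Type*} {P : SpinStructure M C ι} {Ψ : SpinorField P}
  {cov lc : AffineConnection M} {A : Π x : M, TangentSpace 𝓘(ℝ, E4) x} {i : ι} {x : M}

namespace SpinorField

theorem spinCurrent_eq (i : ι) (x : M) (μ ν ξ : Fin 4) :
    Ψ.spinCurrent i x μ ν ξ = -4 * ∑ r, (levi r μ ν ξ : ℂ) * Ψ.chiralCurrent i x r := by
  rw [spinCurrent, clifford_triple C.clifford, bil, Finset.mul_sum]
  simp only [sum_apply, map_sum, smul_apply, map_smul, smul_eq_mul]
  refine Finset.sum_congr rfl fun r _ => ?_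
  rw [levi_swap_right r ν μ ξ, levi_swap_mid r μ ν ξ, chiralCurrent, bil, DiracModule.γ5]
  push_cast
  ring

theorem sum_form_deriv (Ψ : SpinorField P) (cov : AffineConnection M) (i : ι) (x : M) :
    ∑ ρ, Ψ.kin cov i x ρ ρ =
      C.form (Ψ.ψ i x) (Ψ.dirac cov i x) + C.form (Ψ.dirac cov i x) (Ψ.ψ i x) := by
  simp only [kin, dirac, Finset.sum_sub_distrib, map_sum, sum_apply, C.form_skew,
    Finset.sum_neg_distrib]
  ring

/-- Since m is real, both terms in `sum_form_deriv` equal m ψ̄ψ. So the factor of g in the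
Einstein–Cartan equation is zero on solutions of the Dirac equation. -/
theorem kin_trace_of_dirac {m : ℝ} (h : Ψ.dirac cov i x = (m : ℂ) • Ψ.ψ i x) :
    (1 / 2) * ∑ ρ, Ψ.kin cov i x ρ ρ - (m : ℂ) * Ψ.bil 1 i x = 0 := by
  rw [sum_form_deriv, h, C.form_smul_left, map_smul, Complex.conj_ofReal, smul_eq_mul, bil,
    one_apply_eq_self]
  ring

end SpinorField

theorem SpinStructure.HasAxialTorsion.trTors_eq_zero (hA : P.HasAxialTorsion cov A)
    (hx : x ∈ P.U i) (ρ : Fin 4) :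
    P.trTors cov i x ρ = 0 := by
  simp [SpinStructure.trTors, hA i x hx, levi_self_mid]

theorem SpinStructure.starExtD_swap (A : Π x : M, TangentSpace 𝓘(ℝ, E4) x)
    (i : ι) (x : M) (μ ν : Fin 4) :
    P.starExtD A i x ν μ = -P.starExtD A i x μ ν := by
  simp only [SpinStructure.starExtD, levi_swap_right _ _ μ ν, neg_mul, Finset.sum_neg_distrib,
    mul_neg]

/-- The torsion equation of the Einstein–Cartan–Dirac system forces the torsion to be axial. -/
theorem SpinorField.EinsteinCartanDirac.hasAxialTorsion {m c : ℝ}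
    (h : Ψ.EinsteinCartanDirac cov m c) (hc : ∀ i, ∀ x ∈ P.U i, ∀ ξ,
      (P.comp A i x ξ : ℂ) = (c : ℂ) * Ψ.chiralCurrent i x ξ) : P.HasAxialTorsion cov A := by
  intro i x hx
  have h1 : ∀ μ ν ξ, P.tors cov i x μ ν ξ - P.trTors cov i x ξ * kron μ ν
      + P.trTors cov i x ν * kron μ ξ = ∑ r, P.comp A i x r * levi r μ ν ξ := by
    intro μ ν ξ
    have h2 := h.torsion i x hx μ ν ξ
    rw [SpinorField.spinCurrent_eq] at h2
    have h3 : ((∑ r, P.comp A i x r * levi r μ ν ξ : ℝ) : ℂ) =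
        -((c : ℂ) / 4) * (-4 * ∑ r, (levi r μ ν ξ : ℂ) * Ψ.chiralCurrent i x r) := by
      push_cast
      simp only [hc i x hx, Finset.mul_sum]
      exact Finset.sum_congr rfl fun _ _ => by ring
    rw [← h3] at h2
    exact_mod_cast h2
  -- Contracting the first two indices gives tr - 4 tr + tr = -2 tr on the left and zero on the
  -- right.
  have htr : ∀ ρ, P.trTors cov i x ρ = 0 := by
    intro ρ
    have h2 : ∑ σ, (P.tors cov i x σ σ ρ - P.trTors cov i x ρ * kron σ σ
        + P.trTors cov i x σ * kron σ ρ) = 0 := by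
      simp [h1, levi_self_mid]
    rw [Finset.sum_add_distrib, Finset.sum_sub_distrib] at h2
    simp [kron] at h2
    have h3 : ∑ σ, P.tors cov i x σ σ ρ = P.trTors cov i x ρ := rfl
    linarith
  intro τ μ ν
  have := h1 τ μ ν
  simpa [htr] using this

variable [IsContMDiffRiemannianBundle 𝓘(ℝ, E4) ∞ E4 (fun x : M => TangentSpace 𝓘(ℝ, E4) x)]

namespace SpinStructure.HasAxialTorsion

/-- The contorsion ½T enters the spin connection with -¼. Reordering ε_{ξaμb} to ε_{ξμab} changes
the sign, so the factor is +⅛. -/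
theorem deriv_eq (hA : P.HasAxialTorsion cov A) (hlc : IsLeviCivita lc)
    (hcov : IsMetricConnection cov) (hx : x ∈ P.U i) (μ : Fin 4) :
    Ψ.deriv cov i x μ = Ψ.deriv lc i x μ
      + (1 / 8 : ℂ) • C.bivec (DiracModule.axialBivec (P.comp A i x) μ) (Ψ.ψ i x) := by
  have h : ∀ a b, P.connForm cov i x μ a b = P.connForm lc i x μ a b
      - (1 / 2) * DiracModule.axialBivec (P.comp A i x) μ a b := by
    intro a b
    rw [hA.connForm_eq hlc hcov hx, DiracModule.axialBivec, sub_eq_add_neg, ← mul_neg,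
      ← Finset.sum_neg_distrib]
    congr 2
    exact Finset.sum_congr rfl fun ξ _ => by rw [levi_swap_mid]; ring
  rw [SpinorField.deriv, SpinorField.deriv, DiracModule.bivec]
  simp only [h, sum_apply, smul_apply, Complex.ofReal_sub, sub_smul, Finset.sum_sub_distrib,
    Finset.smul_sum, smul_sub, DiracModule.mul_apply]
  rw [← sub_add]
  congr 1
  refine Finset.sum_congr rfl fun a _ => Finset.sum_congr rfl fun b _ => ?_
  push_cast
  module

/-- The constant ¾ is ⅛ of the 6 in `sum_γ_mul_axialBivec`. -/
theorem dirac_eq (hA : P.HasAxialTorsion cov A) (hlc : IsLeviCivita lc)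
    (hcov : IsMetricConnection cov) (hx : x ∈ P.U i) :
    Ψ.dirac cov i x = Ψ.dirac lc i x
      - (3 / 4 : ℂ) • ∑ ξ, ((P.comp A i x ξ : ℝ) : ℂ) • C.γ ξ (C.γ5 (Ψ.ψ i x)) := by
  have h := congrArg (fun B : S →L[ℂ] S => B (Ψ.ψ i x)) (C.sum_γ_mul_axialBivec (P.comp A i x))
  simp only [sum_apply, smul_apply, DiracModule.mul_apply] at h
  simp only [SpinorField.dirac, hA.deriv_eq hlc hcov hx, map_add, map_smul,
    Finset.sum_add_distrib, ← Finset.smul_sum, h]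
  module

/-- The bivector is skew for the spinor metric, so the two halves of the two-sided derivative
combine into the anticommutator of γ_μ with it. -/
theorem kin_eq (hA : P.HasAxialTorsion cov A) (hlc : IsLeviCivita lc)
    (hcov : IsMetricConnection cov) (hx : x ∈ P.U i) (μ ν : Fin 4) :
    Ψ.kin cov i x μ ν = Ψ.kin lc i x μ ν
      - (1 / 2) * ((kron μ ν : ℂ) * ∑ ξ, (P.comp A i x ξ : ℂ) * Ψ.chiralCurrent i x ξ
        - (P.comp A i x μ : ℂ) * Ψ.chiralCurrent i x ν) := by
  have h := congrArg (fun B : S →L[ℂ] S => C.form (Ψ.ψ i x) (B (Ψ.ψ i x)))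
    (C.γ_mul_axialBivec_add (P.comp A i x) μ ν)
  simp only [add_apply, sub_apply, sum_apply, smul_apply, DiracModule.mul_apply, map_add,
    map_sub, map_sum, map_smul, smul_eq_mul] at h
  have h8 : starRingEnd ℂ (1 / 8) = 1 / 8 := by
    rw [show (1 / 8 : ℂ) = ((1 / 8 : ℝ) : ℂ) by norm_num]
    exact Complex.conj_ofReal _
  simp only [SpinorField.kin, hA.deriv_eq hlc hcov hx, map_add, map_smul, C.form_smul_left, add_apply,
    C.form_bivec_left (DiracModule.axialBivec_swap _ ν), h8, smul_eq_mul,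
    SpinorField.chiralCurrent, SpinorField.bil, DiracModule.mul_apply]
  linear_combination (1 / 8) * h

end SpinStructure.HasAxialTorsion

variable [T2Space M]

/-- For a metric connection whose torsion is axial, with the axial vector determined by the spinor
field, the two systems of equations agree. -/
theorem einsteinCartanDirac_iff_leviCivitaAxial (hA : P.HasAxialTorsion cov A)
    (hlc : IsLeviCivita lc) (hcov : IsMetricConnection cov) (hAs : SmoothVectorFieldOn A Set.univ)
    {m c : ℝ} (hc : ∀ i, ∀ x ∈ P.U i, ∀ ξ,
      (P.comp A i x ξ : ℂ) = (c : ℂ) * Ψ.chiralCurrent i x ξ) :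
    Ψ.EinsteinCartanDirac cov m c ↔ Ψ.LeviCivitaAxial lc A m c := by
  have hkron : ∀ μ ν, kron ν μ = kron μ ν := fun μ ν => by simp [kron, eq_comm]
  have hsymm : ∀ i, ∀ x ∈ P.U i, ∀ μ ν, (P.ric lc i x μ ν : ℂ) = (P.ric lc i x ν μ : ℂ) :=
    fun i x hx μ ν => by rw [P.ric_symm hlc hx]
  constructor
  · intro h
    have hd : ∀ i, ∀ x ∈ P.U i, Ψ.dirac cov i x = (m : ℂ) • Ψ.ψ i x := by
      intro i x hx
      have := h.dirac i x hx
      simp only [hA.trTors_eq_zero hx, Complex.ofReal_zero, zero_smul, Finset.sum_const_zero,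
        smul_zero, sub_zero] at this
      exact sub_eq_zero.1 this
    -- The Einstein–Cartan equation in Levi-Civita terms; its symmetric and antisymmetric parts are
    -- the two equations to be proved.
    have he : ∀ i, ∀ x ∈ P.U i, ∀ μ ν, (2 * P.ric lc i x μ ν - kron μ ν * P.scal lc i x
        - P.starExtD A i x μ ν + (1 / 2) * P.sqLength A i x * kron μ ν
        + P.comp A i x μ * P.comp A i x ν : ℂ) =
        -(1 / 2) * (Ψ.kin lc i x μ ν
          - (1 / 2) * ((kron μ ν : ℂ) * ∑ ξ, (P.comp A i x ξ : ℂ) * Ψ.chiralCurrent i x ξ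
            - (P.comp A i x μ : ℂ) * Ψ.chiralCurrent i x ν)) := by
      intro i x hx μ ν
      have := h.einstein i x hx μ ν
      rw [SpinorField.kin_trace_of_dirac (hd i x hx), hA.ric_eq hlc hcov hAs hx,
        hA.scal_eq hlc hcov hAs hx, hA.kin_eq hlc hcov hx] at this
      push_cast at this
      linear_combination this
    refine ⟨fun i x hx μ ν => ?_, fun i x hx μ ν => ?_, hc, fun i x hx => ?_⟩
    · have h1 := he i x hx μ ν
      have h2 := he i x hx ν μ
      rw [SpinStructure.starExtD_swap, hkron, hsymm i x hx ν μ] at h2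
      push_cast at h1 h2 ⊢
      linear_combination (1 / 2) * h1 + (1 / 2) * h2
    · have h1 := he i x hx μ ν
      have h2 := he i x hx ν μ
      rw [SpinStructure.starExtD_swap, hkron, hsymm i x hx ν μ] at h2
      push_cast at h1 h2 ⊢
      linear_combination (-1 / 2) * h1 + (1 / 2) * h2
    · rw [← hA.dirac_eq hlc hcov hx, hd i x hx, sub_self]
  · intro h
    have hd : ∀ i, ∀ x ∈ P.U i, Ψ.dirac cov i x = (m : ℂ) • Ψ.ψ i x := by
      intro i x hx
      rw [hA.dirac_eq hlc hcov hx]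
      exact sub_eq_zero.1 (h.dirac i x hx)
    refine ⟨fun i x hx μ ν => ?_, fun i x hx μ ν ξ => ?_, fun i x hx => ?_⟩
    · have h1 := h.einstein i x hx μ ν
      have h2 := h.star_dA i x hx μ ν
      rw [SpinorField.kin_trace_of_dirac (hd i x hx), hA.ric_eq hlc hcov hAs hx,
        hA.scal_eq hlc hcov hAs hx, hA.kin_eq hlc hcov hx]
      push_cast at h1 h2 ⊢
      -- The two parts are added back; ⋆dA enters the Ricci tensor with a minus sign.
      linear_combination h1 - h2
    · rw [hA.trTors_eq_zero hx, hA.trTors_eq_zero hx, hA i x hx, SpinorField.spinCurrent_eq]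
      push_cast
      simp only [hc i x hx, zero_mul, sub_zero, add_zero, Finset.mul_sum]
      exact Finset.sum_congr rfl fun _ _ => by ring
    · simp only [hA.trTors_eq_zero hx, Complex.ofReal_zero, zero_smul, Finset.sum_const_zero,
        smul_zero, sub_zero, hd i x hx, sub_self]

end SpinorEquations

/-! ### Invariance under the spin group -/

namespace DiracModule

variable {S : Type*} [NormedAddCommGroup S] [NormedSpace ℂ S] (C : DiracModule S)

theorem γ_mul_γ {a b : Fin 4} (hab : a ≠ b) : C.γ b * C.γ a = -(C.γ a * C.γ b) := by
  have h := C.clifford a b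
  simp only [kron, if_neg hab] at h
  exact eq_neg_of_add_eq_zero_right (by simpa using h)

theorem γ_mul_γ_mul {a b : Fin 4} (B : S →L[ℂ] S) (hab : a ≠ b) :
    C.γ b * (C.γ a * B) = -(C.γ a * (C.γ b * B)) := by
  rw [← mul_assoc, C.γ_mul_γ hab, neg_mul, mul_assoc]

theorem γ5_eq_rev : C.γ 3 * (C.γ 2 * (C.γ 1 * C.γ 0)) = C.γ5 := by
  have s10 := C.γ_mul_γ (a := 0) (b := 1) (by decide)
  have s21 := C.γ_mul_γ (a := 1) (b := 2) (by decide)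
  have s32 := C.γ_mul_γ (a := 2) (b := 3) (by decide)
  have t20 := fun B => C.γ_mul_γ_mul (a := 0) (b := 2) B (by decide)
  have t30 := fun B => C.γ_mul_γ_mul (a := 0) (b := 3) B (by decide)
  have t31 := fun B => C.γ_mul_γ_mul (a := 1) (b := 3) B (by decide)
  simp only [γ5, mul_assoc, s10, s21, s32, t20, t30, t31, mul_neg, neg_neg]

/-- Four skew factors give sign +1, and reversing their order takes six transpositions, again an
even number (`γ5_eq_rev`). -/
theorem form_γ5_left (s t : S) : C.form (C.γ5 s) t = C.form s (C.γ5 t) := by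
  have h := congrArg (fun B : S →L[ℂ] S => B t) C.γ5_eq_rev
  simp only [mul_apply] at h
  rw [← h]
  simp [γ5, C.form_skew]

theorem γ_mul_γ5 (a : Fin 4) : C.γ a * C.γ5 = -(C.γ5 * C.γ a) := by
  have h := fun a b => C.γ_mul_γ (a := a) (b := b)
  have h' := fun a b x => C.γ_mul_γ_mul (a := a) (b := b) x
  have s30 := h 0 3 (by decide)
  have s31 := h 1 3 (by decide)
  have s32 := h 2 3 (by decide)
  have t10 := fun x => h' 0 1 x (by decide)
  have t20 := fun x => h' 0 2 x (by decide)
  have t30 := fun x => h' 0 3 x (by decide)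
  have t21 := fun x => h' 1 2 x (by decide)
  have t31 := fun x => h' 1 3 x (by decide)
  have t32 := fun x => h' 2 3 x (by decide)
  fin_cases a <;>
    simp [γ5, mul_assoc, s30, s31, s32, t10, t20, t30, t21, t31, t32]

theorem vec_mul_γ5 (u : E4) : C.vec u * C.γ5 = -(C.γ5 * C.vec u) := by
  simp only [vec, Finset.sum_mul, Finset.mul_sum, ← Finset.sum_neg_distrib, smul_mul_assoc,
    mul_smul_comm, γ_mul_γ5, smul_neg]

theorem vec_mul_vec {u : E4} (hu : ‖u‖ = 1) : C.vec u * C.vec u = -1 := by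
  have h2 : C.vec u * C.vec u = ∑ a, ∑ b, ((u a * u b : ℝ) : ℂ) • (C.γ b * C.γ a) := by
    simp only [vec, Finset.sum_mul, Finset.mul_sum, smul_mul_assoc, mul_smul_comm,
      Finset.smul_sum, smul_smul, Complex.ofReal_mul]
  have h1 : C.vec u * C.vec u = ∑ a, ∑ b, ((u a * u b : ℝ) : ℂ) • (C.γ a * C.γ b) := by
    rw [h2, Finset.sum_comm]
    exact Finset.sum_congr rfl fun a _ => Finset.sum_congr rfl fun b _ => by rw [mul_comm (u b)]
  have h3 : C.vec u * C.vec u + C.vec u * C.vec u =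
      ∑ a, ((-2 * (u a * u a) : ℝ) : ℂ) • (1 : S →L[ℂ] S) := by
    nth_rewrite 1 [h1]
    rw [h2, ← Finset.sum_add_distrib]
    refine Finset.sum_congr rfl fun a _ => ?_
    rw [← Finset.sum_add_distrib]
    simp only [← smul_add, C.clifford, smul_smul, ← Complex.ofReal_mul, ← Finset.sum_smul,
      ← Complex.ofReal_sum]
    congr 2
    simp [kron]
    ring
  have h4 : ∑ a, u a * u a = 1 := by
    have := EuclideanSpace.real_norm_sq_eq u
    rw [hu] at this
    simp only [pow_two] at this
    linarith
  rw [← Finset.sum_smul, ← Complex.ofReal_sum, ← Finset.mul_sum, h4] at h3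
  have h5 : C.vec u * C.vec u = (1 / 2 : ℂ) • (C.vec u * C.vec u + C.vec u * C.vec u) := by module
  rw [h5, h3]
  push_cast
  module

theorem form_vec_left (u : E4) (s t : S) : C.form (C.vec u s) t = -C.form s (C.vec u t) := by
  simp [vec, C.form_skew, -Complex.coe_smul]

/-- Multiplication by a unit vector u is skew with square -1, hence an isometry of the spinor
metric; the property passes to products. -/
theorem spin_form {g : S →L[ℂ] S} (hg : g ∈ C.spin) : ∀ s t, C.form (g s) (g t) = C.form s t := by
  induction hg using Submonoid.closure_induction with
  | mem g hg =>
    obtain ⟨u, v, hu, hv, rfl⟩ := hg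
    intro s t
    have h : ∀ {u : E4}, ‖u‖ = 1 → ∀ s, C.vec u (C.vec u s) = -s := fun {u} hu s => by
      have := congrArg (fun B : S →L[ℂ] S => B s) (C.vec_mul_vec hu)
      simpa [mul_apply] using this
    rw [mul_apply, mul_apply, form_vec_left, h hu, map_neg, neg_neg, form_vec_left, h hv, map_neg,
      neg_neg]
  | one => intro s t; rfl
  | mul g h _ _ ihg ihh => intro s t; rw [mul_apply, mul_apply, ihg, ihh]

/-- Vectors anticommute with γ₅, so products of an even number of them commute with it. -/
theorem spin_γ5 {g : S →L[ℂ] S} (hg : g ∈ C.spin) : g * C.γ5 = C.γ5 * g := by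
  induction hg using Submonoid.closure_induction with
  | mem g hg =>
    obtain ⟨u, v, -, -, rfl⟩ := hg
    rw [mul_assoc, vec_mul_γ5, mul_neg, ← mul_assoc, vec_mul_γ5, neg_mul, neg_neg, mul_assoc]
  | one => simp
  | mul g h _ _ ihg ihh => rw [mul_assoc, ihh, ← mul_assoc, ihg, mul_assoc]

/-- The real part of `s̄ {[B₂, B₃], B₁} s`. -/
def spinTriple (s : S) (B₁ B₂ B₃ : S →L[ℂ] S) : ℝ :=
  (C.form s (((B₂ * B₃ - B₃ * B₂) * B₁ + B₁ * (B₂ * B₃ - B₃ * B₂)) s)).re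

theorem spinTriple_sum (s : S) (u v w : Fin 4 → ℝ) :
    C.spinTriple s (∑ a, (u a : ℂ) • C.γ a) (∑ a, (v a : ℂ) • C.γ a) (∑ a, (w a : ℂ) • C.γ a) =
      ∑ a, ∑ b, ∑ c, u a * v b * w c * C.spinTriple s (C.γ a) (C.γ b) (C.γ c) := by
  have l1 : ∀ B₂ B₃, IsLinearMap ℝ fun B₁ => C.spinTriple s B₁ B₂ B₃ := fun B₂ B₃ =>
    ⟨fun x y => by simp [spinTriple, mul_add, add_mul]; ring,
      fun r x => by simp [spinTriple]; ring⟩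
  have l2 : ∀ B₁ B₃, IsLinearMap ℝ fun B₂ => C.spinTriple s B₁ B₂ B₃ := fun B₂ B₃ =>
    ⟨fun x y => by simp [spinTriple, mul_add, add_mul]; ring,
      fun r x => by simp [spinTriple]; ring⟩
  have l3 : ∀ B₁ B₂, IsLinearMap ℝ fun B₃ => C.spinTriple s B₁ B₂ B₃ := fun B₂ B₃ =>
    ⟨fun x y => by simp [spinTriple, mul_add, add_mul]; ring,
      fun r x => by simp [spinTriple]; ring⟩
  have key : ∀ {f : (S →L[ℂ] S) → ℝ}, IsLinearMap ℝ f → ∀ u : Fin 4 → ℝ,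
      f (∑ a, (u a : ℂ) • C.γ a) = ∑ a, u a * f (C.γ a) := by
    intro f hf u
    have h := map_sum hf.mk' (fun a => (u a : ℂ) • C.γ a) Finset.univ
    simp only [IsLinearMap.mk'_apply] at h
    rw [h]
    exact Finset.sum_congr rfl fun a _ => by rw [Complex.coe_smul, hf.map_smul, smul_eq_mul]
  rw [key (l1 _ _)]
  refine Finset.sum_congr rfl fun a _ => ?_
  rw [key (l2 _ _), Finset.mul_sum]
  refine Finset.sum_congr rfl fun b _ => ?_
  rw [key (l3 _ _), Finset.mul_sum, Finset.mul_sum]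
  exact Finset.sum_congr rfl fun c _ => by ring

end DiracModule

/-! ### The chiral current as a global smooth vector field -/

section AxialField

open Filter Topology

variable {M : Type*} [TopologicalSpace M] [ChartedSpace E4 M] [IsManifold 𝓘(ℝ, E4) ∞ M]
  [Bundle.RiemannianBundle (fun x : M => TangentSpace 𝓘(ℝ, E4) x)]
  {S : Type*} [NormedAddCommGroup S] [NormedSpace ℂ S]
  {C : DiracModule S} {ι : Type*} {P : SpinStructure M C ι} {i j : ι} {x : M}

namespace SpinStructure

variable (P) in
/-- Clifford multiplication by a tangent vector, in the trivialisation `i`. -/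
def cliff (i : ι) (x : M) (u : TangentSpace 𝓘(ℝ, E4) x) : S →L[ℂ] S :=
  ∑ a, ((inner ℝ (P.frame i a x) u : ℝ) : ℂ) • C.γ a

theorem cliff_frame (hx : x ∈ P.U i) (a : Fin 4) : P.cliff i x (P.frame i a x) = C.γ a := by
  simp [cliff, P.frame_orthonormal i x hx, kron]

theorem trans_mul_cliff (hx : x ∈ P.U i ∩ P.U j) (u : TangentSpace 𝓘(ℝ, E4) x) :
    P.trans i j x * P.cliff j x u = P.cliff i x u * P.trans i j x := by
  have h : ∀ b, ∑ a, inner ℝ (P.frame j a x) u * inner ℝ (P.frame i b x) (P.frame j a x) =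
      inner ℝ (P.frame i b x) u := by
    intro b
    rw [← P.sum_inner_frame_mul_inner_frame hx.2 (P.frame i b x) u]
    exact Finset.sum_congr rfl fun a _ => by rw [real_inner_comm (P.frame i b x), mul_comm]
  simp only [cliff, Finset.mul_sum, mul_smul_comm, P.trans_frame i j x hx, Finset.sum_mul,
    Finset.smul_sum, smul_mul_assoc, smul_smul]
  rw [Finset.sum_comm]
  refine Finset.sum_congr rfl fun b _ => ?_
  rw [← Finset.sum_smul, ← h b]
  push_cast
  rfl

end SpinStructure

namespace SpinorField

variable (Ψ : SpinorField P)

theorem form_eq_of_intertwine (hx : x ∈ P.U i ∩ P.U j) {B B' : S →L[ℂ] S}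
    (h : P.trans i j x * B' = B * P.trans i j x) :
    C.form (Ψ.ψ i x) (B (Ψ.ψ i x)) = C.form (Ψ.ψ j x) (B' (Ψ.ψ j x)) := by
  have h1 := congrArg (fun B : S →L[ℂ] S => B (Ψ.ψ j x)) h
  simp only [DiracModule.mul_apply] at h1
  rw [Ψ.compat i j x hx, ← h1, C.spin_form (P.trans_mem i j x hx)]

theorem chiralCurrent_trans (hx : x ∈ P.U i ∩ P.U j) (a : Fin 4) :
    Ψ.chiralCurrent i x a =
      ∑ ξ, ((inner ℝ (P.frame j ξ x) (P.frame i a x) : ℝ) : ℂ) * Ψ.chiralCurrent j x ξ := by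
  have h : P.trans i j x * (P.cliff j x (P.frame i a x) * C.γ5) =
      C.γ a * C.γ5 * P.trans i j x := by
    rw [← mul_assoc, SpinStructure.trans_mul_cliff hx, SpinStructure.cliff_frame hx.1, mul_assoc,
      C.spin_γ5 (P.trans_mem i j x hx), mul_assoc]
  rw [chiralCurrent, bil, Ψ.form_eq_of_intertwine hx h]
  simp only [SpinStructure.cliff, Finset.sum_mul, smul_mul_assoc, sum_apply, smul_apply, map_sum,
    map_smul, smul_eq_mul, chiralCurrent, bil]

/-- This makes the contorsion below well defined: the orientation is carried by the Clifford
products, so no ε symbol has to be transformed between frames. -/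
theorem spinTriple_cliff_trans (hx : x ∈ P.U i ∩ P.U j) (u v w : TangentSpace 𝓘(ℝ, E4) x) :
    C.spinTriple (Ψ.ψ i x) (P.cliff i x u) (P.cliff i x v) (P.cliff i x w) =
      C.spinTriple (Ψ.ψ j x) (P.cliff j x u) (P.cliff j x v) (P.cliff j x w) := by
  have hs : ∀ B₁ B₂ B₁' B₂' : S →L[ℂ] S, P.trans i j x * B₁' = B₁ * P.trans i j x →
      P.trans i j x * B₂' = B₂ * P.trans i j x →
      P.trans i j x * (B₁' * B₂') = B₁ * B₂ * P.trans i j x := by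
    intro B₁ B₂ B₁' B₂' h1 h2
    rw [← mul_assoc, h1, mul_assoc, h2, mul_assoc]
  have t := fun u => SpinStructure.trans_mul_cliff (P := P) hx u
  rw [DiracModule.spinTriple, DiracModule.spinTriple, Ψ.form_eq_of_intertwine hx]
  have hc : P.trans i j x * (P.cliff j x v * P.cliff j x w - P.cliff j x w * P.cliff j x v) =
      (P.cliff i x v * P.cliff i x w - P.cliff i x w * P.cliff i x v) * P.trans i j x := by
    rw [mul_sub, sub_mul, hs _ _ _ _ (t v) (t w), hs _ _ _ _ (t w) (t v)]
  rw [mul_add, add_mul, hs _ _ _ _ hc (t u), hs _ _ _ _ (t u) hc]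

/-- Conjugation moves γ_aγ₅ to the other side: γ₅ is self-adjoint, γ_a is skew, and they
anticommute, so the two signs cancel. -/
theorem ofReal_re_chiralCurrent (i : ι) (x : M) (a : Fin 4) :
    ((Ψ.chiralCurrent i x a).re : ℂ) = Ψ.chiralCurrent i x a := by
  refine Complex.conj_eq_iff_re.1 ?_
  have h := congrArg (fun B : S →L[ℂ] S => B (Ψ.ψ i x)) (C.γ_mul_γ5 a)
  simp only [DiracModule.mul_apply, neg_apply] at h
  rw [chiralCurrent, bil, C.form_symm, DiracModule.mul_apply, C.form_skew, C.form_γ5_left, h]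
  simp

/-- The vector field with components `c ψ̄ γ^ξ γ₅ ψ`. -/
def axialField (c : ℝ) (x : M) : TangentSpace 𝓘(ℝ, E4) x :=
  ∑ ξ, (c * (Ψ.chiralCurrent (P.cover x).choose x ξ).re) • P.frame (P.cover x).choose ξ x

/-- The field is built from an arbitrarily chosen trivialisation at each point; its components are
the current in every trivialisation, which also yields smoothness. -/
theorem comp_axialField (c : ℝ) (hx : x ∈ P.U i) (a : Fin 4) :
    (P.comp (Ψ.axialField c) i x a : ℂ) = (c : ℂ) * Ψ.chiralCurrent i x a := by
  rw [Ψ.chiralCurrent_trans ⟨hx, (P.cover x).choose_spec⟩, SpinStructure.comp, axialField]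
  simp only [inner_sum, inner_smul_right, Complex.ofReal_sum, Finset.mul_sum, Complex.ofReal_mul,
    ofReal_re_chiralCurrent]
  exact Finset.sum_congr rfl fun ξ _ => by rw [real_inner_comm]; ring

theorem contMDiffAt_bil (hx : x ∈ P.U i) (B : S →L[ℂ] S) :
    ContMDiffAt 𝓘(ℝ, E4) 𝓘(ℝ, ℂ) ∞ (fun y => Ψ.bil B i y) x := by
  have hb : IsBoundedBilinearMap ℝ (fun p : S × S => C.form p.1 p.2) :=
    { add_left := fun x y z => by simp
      smul_left := fun r x y => by
        rw [← Complex.coe_smul, C.form_smul_left, Complex.conj_ofReal, Complex.real_smul]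
      add_right := fun x y z => by simp
      smul_right := fun r x y => by
        rw [← Complex.coe_smul, map_smul, Complex.coe_smul]
      bound := ⟨‖C.form‖ + 1, by positivity, fun x y => (C.form.le_opNorm₂ x y).trans (by
        gcongr; linarith)⟩ }
  have hψ := (Ψ.smooth i).contMDiffAt (P.mem_nhds_U hx)
  have hB : ContMDiffAt 𝓘(ℝ, E4) 𝓘(ℝ, S) ∞ (fun y => B (Ψ.ψ i y)) x :=
    (B.restrictScalars ℝ).contDiff.contMDiff.contMDiffAt.comp x hψ
  exact hb.contDiff.contMDiff.contMDiffAt.comp x (hψ.prodMk_space hB)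

theorem contMDiffAt_chiralCurrent_re (hx : x ∈ P.U i) (a : Fin 4) :
    ContMDiffAt 𝓘(ℝ, E4) 𝓘(ℝ) ∞ (fun y => (Ψ.chiralCurrent i y a).re) x :=
  Complex.reCLM.contDiff.contMDiff.contMDiffAt.comp x (Ψ.contMDiffAt_bil hx _)

theorem smooth_axialField (c : ℝ) : SmoothVectorFieldOn (Ψ.axialField c) Set.univ := by
  intro x _
  obtain ⟨i, hx⟩ := P.cover x
  have h : SmoothVectorFieldAt
      (fun y => ∑ a, (c * (Ψ.chiralCurrent i y a).re) • P.frame i a y) x :=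
    ContMDiffAt.sum_section fun a _ => ContMDiffAt.smul_section
      (contMDiffAt_const.mul (Ψ.contMDiffAt_chiralCurrent_re hx a)) (P.contMDiffAt_frame hx a)
  refine (h.congr_of_eventuallyEq ?_).contMDiffWithinAt
  filter_upwards [P.mem_nhds_U hx] with y hy
  congr 1
  conv_lhs => rw [← P.sum_inner_smul_frame hy (Ψ.axialField c y)]
  refine Finset.sum_congr rfl fun a _ => ?_
  have := congrArg Complex.re (Ψ.comp_axialField c hy a)
  simp only [SpinStructure.comp, Complex.ofReal_re, Complex.re_ofReal_mul] at this
  rw [this]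

end SpinorField

end AxialField

/-! ### A smoothness criterion for endomorphism fields -/

section AxialConnection

open Filter Topology

variable {M : Type*} [TopologicalSpace M] [ChartedSpace E4 M] [IsManifold 𝓘(ℝ, E4) ∞ M]

/-- A field of endomorphisms of the tangent spaces is smooth at a point if it maps vector fields
that are smooth at the point to such vector fields. -/
theorem contMDiffAt_hom_of_apply
    {φ : Π y : M, TangentSpace 𝓘(ℝ, E4) y →L[ℝ] TangentSpace 𝓘(ℝ, E4) y}
    {x : M} (h : ∀ X : Π y : M, TangentSpace 𝓘(ℝ, E4) y, SmoothVectorFieldAt X x →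
      SmoothVectorFieldAt (fun y => φ y (X y)) x) :
    ContMDiffAt 𝓘(ℝ, E4) (𝓘(ℝ, E4).prod 𝓘(ℝ, E4 →L[ℝ] E4)) ∞
      (fun y => Bundle.TotalSpace.mk' (E4 →L[ℝ] E4)
        (E := fun y : M => TangentSpace 𝓘(ℝ, E4) y →L[ℝ] TangentSpace 𝓘(ℝ, E4) y) y (φ y)) x := by
  rw [contMDiffAt_hom_bundle]
  refine ⟨contMDiffAt_id, ?_⟩
  set e := trivializationAt E4 (fun y : M => TangentSpace 𝓘(ℝ, E4) y) x with he
  have hx : x ∈ e.baseSet := FiberBundle.mem_baseSet_trivializationAt' x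
  let b := (EuclideanSpace.basisFun (Fin 4) ℝ).toBasis
  have hk : ∀ k, ContMDiffAt 𝓘(ℝ, E4) 𝓘(ℝ, E4) ∞
      (fun y => ContinuousLinearMap.inCoordinates E4 (fun y : M => TangentSpace 𝓘(ℝ, E4) y) E4
        (fun y : M => TangentSpace 𝓘(ℝ, E4) y) x y x y (φ y) (b k)) x := by
    intro k
    have h1 : SmoothVectorFieldAt (e.localFrame b k) x :=
      contMDiffAt_localFrame_of_mem ∞ e b k hx
    have h2 := (Bundle.contMDiffAt_section _).1 (h _ h1)
    refine h2.congr_of_eventuallyEq ?_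
    filter_upwards [e.open_baseSet.mem_nhds hx] with y hy
    rw [ContinuousLinearMap.inCoordinates_eq hy hy]
    simp [e.localFrame_apply_of_mem_baseSet b hy, Bundle.Trivialization.basisAt]
    rfl
  -- An operator is a smooth (linear) function of its values on a basis, so smoothness of the
  -- finitely many columns `hk` suffices.
  have hsum : ∀ L : E4 →L[ℝ] E4, L = ∑ k, ContinuousLinearMap.smulRightL ℝ E4 E4
      (EuclideanSpace.proj k) (L (b k)) := by
    intro L
    ext1 v
    have hv : v = ∑ k, v k • b k := by
      simpa [b] using ((EuclideanSpace.basisFun (Fin 4) ℝ).sum_repr v).symm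
    conv_lhs => rw [hv]
    simp
  have hs : ContMDiffAt 𝓘(ℝ, E4) 𝓘(ℝ, E4 →L[ℝ] E4) ∞ (fun y => ∑ k,
      ContinuousLinearMap.smulRightL ℝ E4 E4 (EuclideanSpace.proj k)
        (ContinuousLinearMap.inCoordinates E4 (fun y : M => TangentSpace 𝓘(ℝ, E4) y) E4
          (fun y : M => TangentSpace 𝓘(ℝ, E4) y) x y x y (φ y) (b k))) x :=
    contMDiffAt_finsetSum fun k _ =>
      (ContinuousLinearMap.contMDiff _).contMDiffAt.comp x (hk k)
  refine hs.congr_of_eventuallyEq (Eventually.of_forall fun y => ?_)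
  exact hsum _

end AxialConnection

/-! ### The contorsion produced by the spin current -/

section SpinContorsion

open Filter Topology

variable {M : Type*} [TopologicalSpace M] [ChartedSpace E4 M] [IsManifold 𝓘(ℝ, E4) ∞ M]
  [Bundle.RiemannianBundle (fun x : M => TangentSpace 𝓘(ℝ, E4) x)]
  {S : Type*} [NormedAddCommGroup S] [NormedSpace ℂ S]
  {C : DiracModule S} {ι : Type*} {P : SpinStructure M C ι} {i : ι} {x : M}

namespace SpinorField

variable (Ψ : SpinorField P)

/-- The contorsion that the spin of the field produces, as a field of bilinear maps: the first
argument is the differentiated vector, the second one the direction of differentiation. -/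
def spinContorsion (c : ℝ) (x : M) : TangentSpace 𝓘(ℝ, E4) x →L[ℝ] TangentSpace 𝓘(ℝ, E4) x →L[ℝ]
    TangentSpace 𝓘(ℝ, E4) x :=
  ∑ a, ∑ μ, ∑ b, (-(c / 8) *
      C.spinTriple (Ψ.ψ (P.cover x).choose x) (C.γ a) (C.γ μ) (C.γ b)) •
    (innerSL ℝ (P.frame (P.cover x).choose b x)).smulRight
      ((innerSL ℝ (P.frame (P.cover x).choose μ x)).smulRight (P.frame (P.cover x).choose a x))

theorem inner_spinContorsion (c : ℝ) (hx : x ∈ P.U i) (u v w : TangentSpace 𝓘(ℝ, E4) x) :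
    inner ℝ u (Ψ.spinContorsion c x v w) =
      -(c / 8) * C.spinTriple (Ψ.ψ i x) (P.cliff i x u) (P.cliff i x w) (P.cliff i x v) := by
  rw [Ψ.spinTriple_cliff_trans ⟨hx, (P.cover x).choose_spec⟩, SpinStructure.cliff,
    SpinStructure.cliff, SpinStructure.cliff, C.spinTriple_sum, spinContorsion]
  simp only [sum_apply, smul_apply, ContinuousLinearMap.smulRight_apply, innerSL_apply_apply,
    inner_sum, inner_smul_right, Finset.mul_sum]
  refine Finset.sum_congr rfl fun a _ => Finset.sum_congr rfl fun μ _ =>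
    Finset.sum_congr rfl fun b _ => ?_
  rw [real_inner_comm u]
  ring

theorem inner_frame_spinContorsion (c : ℝ) (hx : x ∈ P.U i) (a : Fin 4)
    (v w : TangentSpace 𝓘(ℝ, E4) x) :
    inner ℝ (P.frame i a x) (Ψ.spinContorsion c x v w) =
      ∑ μ, ∑ b, -(c / 8) * C.spinTriple (Ψ.ψ i x) (C.γ a) (C.γ μ) (C.γ b) *
        (inner ℝ (P.frame i μ x) w * inner ℝ (P.frame i b x) v) := by
  rw [Ψ.inner_spinContorsion c hx, SpinStructure.cliff,
    SpinStructure.cliff, SpinStructure.cliff, C.spinTriple_sum]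
  simp only [P.frame_orthonormal i x hx, Finset.mul_sum]
  rw [Finset.sum_eq_single a (fun b _ hb => by simp [kron, hb]) (by simp)]
  refine Finset.sum_congr rfl fun μ _ => Finset.sum_congr rfl fun b _ => ?_
  simp [kron]
  ring

/-- The factor -c/8 is chosen for this: the spin current is -4 times the dual of the chiral current,
which leaves c/2, i.e. half of the axial torsion. -/
theorem spinTriple_eq {c : ℝ} {A : Π x : M, TangentSpace 𝓘(ℝ, E4) x}
    (hc : ∀ ξ, (P.comp A i x ξ : ℂ) = (c : ℂ) * Ψ.chiralCurrent i x ξ) (a μ b : Fin 4) :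
    -(c / 8) * C.spinTriple (Ψ.ψ i x) (C.γ a) (C.γ μ) (C.γ b) =
      (1 / 2) * ∑ ξ, P.comp A i x ξ * levi ξ a μ b := by
  have h : C.spinTriple (Ψ.ψ i x) (C.γ a) (C.γ μ) (C.γ b) = (Ψ.spinCurrent i x a μ b).re := rfl
  have hc' : ∀ ξ, P.comp A i x ξ = c * (Ψ.chiralCurrent i x ξ).re := fun ξ => by
    simpa using congrArg Complex.re (hc ξ)
  rw [h, Ψ.spinCurrent_eq]
  simp only [hc', Finset.mul_sum, Complex.re_sum]
  refine Finset.sum_congr rfl fun ξ _ => ?_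
  rw [← Ψ.ofReal_re_chiralCurrent]
  simp
  ring

theorem smoothVectorFieldAt_spinContorsion [IsContMDiffRiemannianBundle 𝓘(ℝ, E4) ∞ E4
    (fun x : M => TangentSpace 𝓘(ℝ, E4) x)] (c : ℝ) {X Y : Π x : M, TangentSpace 𝓘(ℝ, E4) x}
    (hX : SmoothVectorFieldAt X x) (hY : SmoothVectorFieldAt Y x) :
    SmoothVectorFieldAt (fun y => Ψ.spinContorsion c y (Y y) (X y)) x := by
  obtain ⟨i, hx⟩ := P.cover x
  have h : SmoothVectorFieldAt (fun y => ∑ a, (∑ μ, ∑ b,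
      -(c / 8) * C.spinTriple (Ψ.ψ i y) (C.γ a) (C.γ μ) (C.γ b) *
        (inner ℝ (P.frame i μ y) (X y) * inner ℝ (P.frame i b y) (Y y))) • P.frame i a y) x := by
    refine ContMDiffAt.sum_section fun a _ => ContMDiffAt.smul_section ?_ (P.contMDiffAt_frame hx a)
    refine contMDiffAt_finsetSum fun μ _ => contMDiffAt_finsetSum fun b _ => ?_
    refine (contMDiffAt_const.mul ?_).mul
      (((P.contMDiffAt_frame hx μ).inner hX).mul ((P.contMDiffAt_frame hx b).inner hY))
    exact Complex.reCLM.contDiff.contMDiff.contMDiffAt.comp x (Ψ.contMDiffAt_bil hx _)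
  refine h.congr_of_eventuallyEq ?_
  filter_upwards [P.mem_nhds_U hx] with y hy
  congr 1
  conv_lhs => rw [← P.sum_inner_smul_frame hy (Ψ.spinContorsion c y (Y y) (X y))]
  exact Finset.sum_congr rfl fun a _ => by rw [Ψ.inner_frame_spinContorsion c hy]

/-- Skewness in the outer two slots, inherited from ε through `spinTriple_eq`; it is what makes the
new connection metric. -/
theorem spinContorsion_skew {c : ℝ} {A : Π x : M, TangentSpace 𝓘(ℝ, E4) x} (hx : x ∈ P.U i)
    (hc : ∀ ξ, (P.comp A i x ξ : ℂ) = (c : ℂ) * Ψ.chiralCurrent i x ξ)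
    (u v w : TangentSpace 𝓘(ℝ, E4) x) :
    inner ℝ u (Ψ.spinContorsion c x v w) = -inner ℝ v (Ψ.spinContorsion c x u w) := by
  rw [Ψ.inner_spinContorsion c hx, Ψ.inner_spinContorsion c hx]
  simp only [SpinStructure.cliff, C.spinTriple_sum, Finset.mul_sum, ← Finset.sum_neg_distrib]
  have hs : ∀ a μ b, -(c / 8) * C.spinTriple (Ψ.ψ i x) (C.γ a) (C.γ μ) (C.γ b) =
      -(-(c / 8) * C.spinTriple (Ψ.ψ i x) (C.γ b) (C.γ μ) (C.γ a)) := by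
    intro a μ b
    rw [Ψ.spinTriple_eq hc, Ψ.spinTriple_eq hc, ← mul_neg, ← Finset.sum_neg_distrib]
    congr 1
    refine Finset.sum_congr rfl fun ξ _ => ?_
    rw [levi_swap_mid ξ μ a b, levi_swap_right ξ μ b a, levi_swap_mid ξ b μ a]
    ring
  -- Renaming the outer summation indices aligns the terms with u and v exchanged.
  have hr : ∀ F : Fin 4 → Fin 4 → Fin 4 → ℝ,
      ∑ a, ∑ μ, ∑ b, F a μ b = ∑ a, ∑ μ, ∑ b, F b μ a := by
    intro F
    rw [Finset.sum_comm, Finset.sum_congr rfl fun μ _ => Finset.sum_comm, Finset.sum_comm]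
  rw [hr]
  refine Finset.sum_congr rfl fun a _ => Finset.sum_congr rfl fun μ _ =>
    Finset.sum_congr rfl fun b _ => ?_
  linear_combination (inner ℝ (P.frame i b x) u * inner ℝ (P.frame i μ x) w *
    inner ℝ (P.frame i a x) v) * hs b μ a

/-- The connection with the contorsion that the spin of the field produces. -/
def spinConnection (lc : AffineConnection M) (c : ℝ) : AffineConnection M :=
  lc.addOneForm (Ψ.spinContorsion c)

theorem spinConnection_apply (lc : AffineConnection M) (c : ℝ)
    (Y : Π x : M, TangentSpace 𝓘(ℝ, E4) x) (x : M) (X : TangentSpace 𝓘(ℝ, E4) x) :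
    Ψ.spinConnection lc c Y x X = lc Y x X + Ψ.spinContorsion c x (Y x) X := rfl

theorem connForm_spinConnection {lc : AffineConnection M} {c : ℝ}
    {A : Π x : M, TangentSpace 𝓘(ℝ, E4) x} (hx : x ∈ P.U i)
    (hc : ∀ ξ, (P.comp A i x ξ : ℂ) = (c : ℂ) * Ψ.chiralCurrent i x ξ) (μ a b : Fin 4) :
    P.connForm (Ψ.spinConnection lc c) i x μ a b =
      P.connForm lc i x μ a b + (1 / 2) * ∑ ξ, P.comp A i x ξ * levi ξ a μ b := by
  rw [SpinStructure.connForm, spinConnection_apply, inner_add_right, Ψ.inner_spinContorsion c hx,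
    SpinStructure.cliff_frame hx, SpinStructure.cliff_frame hx, SpinStructure.cliff_frame hx,
    Ψ.spinTriple_eq hc, SpinStructure.connForm]

end SpinorField

end SpinContorsion

/-! ### The spin connection is metric with axial torsion -/

section SpinConnection

open Filter Topology

variable {M : Type*} [TopologicalSpace M] [ChartedSpace E4 M] [IsManifold 𝓘(ℝ, E4) ∞ M]
  [Bundle.RiemannianBundle (fun x : M => TangentSpace 𝓘(ℝ, E4) x)]
  {S : Type*} [NormedAddCommGroup S] [NormedSpace ℂ S]
  {C : DiracModule S} {ι : Type*} {P : SpinStructure M C ι} {i : ι} {x : M}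
  [IsContMDiffRiemannianBundle 𝓘(ℝ, E4) ∞ E4 (fun x : M => TangentSpace 𝓘(ℝ, E4) x)]
  (Ψ : SpinorField P) {lc : AffineConnection M} {A : Π x : M, TangentSpace 𝓘(ℝ, E4) x}

namespace SpinorField

theorem isMetricConnection_spinConnection (hlc : IsLeviCivita lc) {c : ℝ}
    (hc : ∀ i, ∀ x ∈ P.U i, ∀ ξ, (P.comp A i x ξ : ℂ) = (c : ℂ) * Ψ.chiralCurrent i x ξ) :
    IsMetricConnection (Ψ.spinConnection lc c) where
  smooth := by
    refine ⟨⟨fun {σ} hσ x _ => ContMDiffAt.contMDiffWithinAt ?_⟩⟩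
    refine contMDiffAt_hom_of_apply fun X hX => ?_
    have h1 := contMDiffOn_univ.1 (hlc.smooth.contMDiff.contMDiff hσ) x
    have h2 : SmoothVectorFieldAt (fun y => lc σ y (X y)) x :=
      ContMDiffAt.clm_bundle_apply h1 hX
    exact ContMDiffAt.add_section h2 (Ψ.smoothVectorFieldAt_spinContorsion c hX
      ((contMDiffOn_univ.1 hσ x).of_le le_rfl))
  metric := by
    rw [CovariantDerivative.isMetricCompatible_iff]
    intro x X σ τ _ hσ hτ
    obtain ⟨i, hx⟩ := P.cover x
    have h1 := hlc.metric.mvfderiv_inner_eq X hσ hτ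
    rw [h1]
    have h2 := Ψ.spinContorsion_skew hx (hc i x hx) (σ x) (τ x) (X x)
    change inner ℝ (lc σ x (X x)) (τ x) + inner ℝ (σ x) (lc τ x (X x)) =
      inner ℝ (lc σ x (X x) + Ψ.spinContorsion c x (σ x) (X x)) (τ x) +
        inner ℝ (σ x) (lc τ x (X x) + Ψ.spinContorsion c x (τ x) (X x))
    rw [inner_add_left, inner_add_right, h2,
      real_inner_comm (τ x) (Ψ.spinContorsion c x (σ x) (X x))]
    ring

/-- Antisymmetrising ½A^ξε_{ξτμν} in μ and ν doubles it, while the Levi-Civita part cancels against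
the bracket. -/
theorem hasAxialTorsion_spinConnection (hlc : IsLeviCivita lc) {c : ℝ}
    (hc : ∀ i, ∀ x ∈ P.U i, ∀ ξ, (P.comp A i x ξ : ℂ) = (c : ℂ) * Ψ.chiralCurrent i x ξ) :
    P.HasAxialTorsion (Ψ.spinConnection lc c) A := by
  intro i x hx τ μ ν
  have h : ∑ ξ, P.comp A i x ξ * levi ξ τ ν μ = -∑ ξ, P.comp A i x ξ * levi ξ τ μ ν := by
    rw [← Finset.sum_neg_distrib]
    exact Finset.sum_congr rfl fun ξ _ => by rw [levi_swap_right]; ring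
  rw [P.tors_eq _ hx, Ψ.connForm_spinConnection hx (hc i x hx),
    Ψ.connForm_spinConnection hx (hc i x hx), SpinStructure.structureConst_eq hlc hx, h]
  ring

end SpinorField

theorem SpinStructure.HasAxialTorsion.hasHalfTorsionContorsion {cov : AffineConnection M}
    (hA : P.HasAxialTorsion cov A) (hlc : IsLeviCivita lc) (hcov : IsMetricConnection cov) :
    HasHalfTorsionContorsion cov lc := by
  refine SpinStructure.hasHalfTorsionContorsion_of_connForm (P := P) fun x => ?_
  obtain ⟨i, hx⟩ := P.cover x
  exact ⟨i, hx, fun μ a b => by rw [hA.connForm_eq hlc hcov hx, hA i x hx]⟩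

end SpinConnection

end

/-! ### The equivalence and its converse -/

theorem mainTheorem7 {M : Type*} [TopologicalSpace M] [T2Space M] [SecondCountableTopology M]
    [ChartedSpace E4 M] [IsManifold 𝓘(ℝ, E4) ∞ M]
    [Bundle.RiemannianBundle (fun x : M => TangentSpace 𝓘(ℝ, E4) x)]
    [IsContMDiffRiemannianBundle 𝓘(ℝ, E4) ∞ E4 (fun x : M => TangentSpace 𝓘(ℝ, E4) x)]
    {S : Type*} [NormedAddCommGroup S] [NormedSpace ℂ S] [FiniteDimensional ℂ S]
    {C : DiracModule S} {ι : Type*} {P : SpinStructure M C ι} (Ψ : SpinorField P)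
    (lc : AffineConnection M) (hlc : IsLeviCivita lc) (m c : ℝ) :
    (∀ cov : AffineConnection M, IsMetricConnection cov →
      (Ψ.EinsteinCartanDirac cov m c ↔
        ∃! A : (Π x : M, TangentSpace 𝓘(ℝ, E4) x),
          SmoothVectorFieldOn A Set.univ ∧ P.HasAxialTorsion cov A ∧
            HasHalfTorsionContorsion cov lc ∧ Ψ.LeviCivitaAxial lc A m c)) ∧
    (∀ A : (Π x : M, TangentSpace 𝓘(ℝ, E4) x), SmoothVectorFieldOn A Set.univ →
      Ψ.LeviCivitaAxial lc A m c →
        ∃ cov : AffineConnection M, IsMetricConnection cov ∧ P.HasAxialTorsion cov A ∧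
          HasHalfTorsionContorsion cov lc ∧ Ψ.EinsteinCartanDirac cov m c) := by
  refine ⟨fun cov hcov => ⟨fun h => ?_, ?_⟩, fun A hAs h => ?_⟩
  · have hc := fun i x (hx : x ∈ P.U i) => Ψ.comp_axialField c hx
    have hA := h.hasAxialTorsion hc
    have hAs := Ψ.smooth_axialField c
    refine ⟨Ψ.axialField c, ⟨hAs, hA, hA.hasHalfTorsionContorsion hlc hcov,
      (einsteinCartanDirac_iff_leviCivitaAxial hA hlc hcov hAs hc).1 h⟩, ?_⟩
    -- Uniqueness comes from the axial equation alone, which fixes every frame component of A.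
    rintro A ⟨-, -, -, hLC⟩
    funext x
    obtain ⟨i, hx⟩ := P.cover x
    refine P.ext_inner_frame hx fun a => ?_
    have := (hLC.axial i x hx a).trans (hc i x hx a).symm
    exact_mod_cast this
  · rintro ⟨A, ⟨hAs, hA, -, h⟩, -⟩
    exact (einsteinCartanDirac_iff_leviCivitaAxial hA hlc hcov hAs h.axial).2 h
  -- The axial equation identifies the given A with the current from which the connection is built.
  · have hcov := Ψ.isMetricConnection_spinConnection hlc h.axial
    have hA := Ψ.hasAxialTorsion_spinConnection hlc h.axial
    exact ⟨_, hcov, hA, hA.hasHalfTorsionContorsion hlc hcov,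
      (einsteinCartanDirac_iff_leviCivitaAxial hA hlc hcov hAs h.axial).2 h⟩
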